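/- **Asymptotic optimality of adaptive karma pacing under stationary competition.** *Model.* Let $0<\Delta\le 1$ and let $\gamma,N$ be integers with $1\le\gamma\le N-1$. In periods $t=1,\dots,T$ an agent has a valuation $v_t$ with law $\mathcal V$ on $[0,1]$ and faces competing bids $d_t=(d_t^{\gamma},d_t^{\gamma+1})$ with law $\mathcal D$, where $0\le d^{\gamma+1}\le d^{\gamma}$ almost surely. All $v_t$ and $d_t$ are independent, and $\mathcal V$ has a density bounded by $\bar\nu$. An agent bidding $b$ wins iff $b>d^\gamma$; then it incurs cost $v(1-\Delta)$ and pays $z=d^\gamma$, and otherwise it incurs cost $v$ and pays $z=0$. In all cases it gains $g(b,d)=\frac{\gamma}{N}p$, where $p=d^\gamma$ if $d^\gamma<b$, $p=b$ if $d^{\gamma+1}<b\le d^\gamma$, and $p=d^{\gamma+1}$ if $b\le d^{\gamma+1}$. *Strategy $K$.* Given $0<\underline\mu<\overline\mu$, a step size $\epsilon>0$, an initial multiplier $\mu_1\in[\underline\mu,\overline\mu]$ and an initial budget $k_1>0$, the agent bids $b_t=\min\{\Delta v_t/P_{[\underline\mu,\overline\mu]}(\mu_t),\,k_t\}$, where $P_{[\underline\mu,\overline\mu]}$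 is the projection on $[\underline\mu,\overline\mu]$, and updates $\mu_{t+1}=\mu_t+\epsilon(z_t-g_t)$ and $k_{t+1}=k_t-z_t+g_t$. Its total cost over $T$ periods is $\mathcal C^K(\boldsymbol v,\boldsymbol d)$. The optimal cost in hindsight $\mathcal C^H(\boldsymbol v,\boldsymbol d)$ is the least total cost over all $\boldsymbol b\in\mathbb R_+^T$ with $\sum_{t\le s}z_t\le k_1+\sum_{t<s}g_t$ for every $s\in\{1,\dots,T\}$. The hitting time $\mathscr T$ is the largest $t\le T$ such that $k_s\ge\Delta/\underline\mu$ and $\underline\mu\le\mu_s\le\overline\mu$ for all $1\le s\le t$ (and $0$ if there is none). The residual gain is $\hat\varepsilon=\frac{\gamma}{N}\mathbb E[d^\gamma-d^{\gamma+1}]$. For $\mu>0$ put $$Z(\mu)=\mathbb E\big[d^\gamma\mathbf 1\{\Delta v>\mu d^\gamma\}\big],\quad G(\mu)=\mathbb E\big[g(\tfrac{\Delta v}{\mu},d)\big],\quad L=Z-G,\quad \Psi^0(\mu)=\mathbb E\big[v-\mu\, g(\tfrac{\Delta v}{\mu},d)-(\Delta v-\mu d^\gamma)^+\big].$$ *Assumptions.*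 (1) At every point of $[\underline\mu,\overline\mu]$: $\Psi^0$ is differentiable with derivative $L(\mu)-\mu G'(\mu)$; $Z$ and $G$ are twice differentiable with $|Z'|\le\overline{Z'}$, $|Z''|\le\overline{Z''}$, $|G'|\le\overline{G'}$, $|G''|\le\overline{G''}$, where these four bounds are positive. There is a stationary multiplier $\mu^\star\in(\underline\mu,\overline\mu)$ with $L(\mu^\star)=0$, and $L$ is strongly decreasing about it: for some $\lambda>0$, $(L(\mu)-L(\mu^\star))(\mu-\mu^\star)\le-\lambda(\mu-\mu^\star)^2$ for all $\mu\in[\underline\mu,\overline\mu]$. (2) $\mathcal D$ is supported in $[0,\Delta/\underline\mu]^2$, $0<k_1/T<(1-\frac{\gamma}{N})\mathbb E[d^\gamma]$, and $\epsilon\le\min\{\frac1{2\lambda},\frac1{\overline{Z'}+\overline{G'}}\}$. *Theorem.* There is a constant $C\ge0$, depending only on $\Delta,\underline\mu,\overline\mu,\lambda,\overline{Z'},\overline{Z''},\overline{G'},\overline{G''},\bar\nu$, such that the following holds. (i) For every $T\ge1$, under (1) and (2), the regret $\mathcal C^K-\mathcal C^H$ and $T-\mathscr T$ are integrable and $$\frac1T\,\mathbb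 E\big[\mathcal C^K(\boldsymbol v,\boldsymbol d)-\mathcal C^H(\boldsymbol v,\boldsymbol d)\big]\le C\Big(\epsilon+\frac1{\epsilon T}+\frac{k_1}{T}+\frac{\mathbb E[T-\mathscr T]}{T}+\hat\varepsilon\Big).$$ (ii) Fix $\Delta,\gamma,N,\mathcal V,\mathcal D,\underline\mu,\overline\mu$, and let $\epsilon,k_1,\mu_1$ depend on $T$ with $k_1(T)/T\to0$, $\epsilon(T)\to0$ and $T\epsilon(T)\to\infty$. Suppose that (1) holds; that $\mathcal V$ is supported in $[\underline v,1]$ with $0<\underline v<1$ and $\mathcal D$ in $[\underline d,\overline d]^2$ with $0<\underline d<\overline d$; and that for all large $T$, (2) holds together with $\underline\mu<\frac{\Delta\underline v}{\overline d^2}$, $\overline\mu>\frac{\Delta}{\underline d}$, $\epsilon<\min\big\{\frac{\Delta\underline v}{\overline d^2}-\underline\mu,\ \frac1{\overline d}\big(\overline\mu-\frac{\Delta}{\underline d}\big)\big\}$ and $k_1>\frac{\overline\mu-\mu_1}{\epsilon}+\frac{\Delta}{\underline\mu}$. Then the limit $$\ell=\lim_{T\to\infty}\frac1T\,\mathbb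 E\big[\mathcal C^K(\boldsymbol v,\boldsymbol d)-\mathcal C^H(\boldsymbol v,\boldsymbol d)\big]$$ exists and $|\ell|\le C\hat\varepsilon$. If moreover $\underline\mu<\Delta\underline v/\overline d$ (which is automatic when $\overline d\ge1$), then $\mathscr T=T$ almost surely for all large $T$. -/

import Mathlib

open MeasureTheory ProbabilityTheory Filter Topology

namespace KarmaPacing

/-- What happens in one period: the valuation `v` together with the pair of competing bids
`(d^γ, d^{γ+1})`, i.e. the `γ`-th and the `(γ+1)`-th highest bid of the other agents. -/
abbrev Sample : Type := ℝ × (ℝ × ℝ)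

/-- The data of the auction: time saved on the priority road, number of winners and number of
agents. -/
structure Auction where
  Δ : ℝ
  γ : ℕ
  N : ℕ

/-- The inputs of adaptive karma pacing: multiplier bounds `lo`, `hi`, gradient step size `ε`,
initial multiplier `μ₁` and initial budget `k₁`. -/
structure Input where
  lo : ℝ
  hi : ℝ
  ε : ℝ
  μ₁ : ℝ
  k₁ : ℝ

noncomputable section

/-- Projection of `x` on `[a, b]`. -/
def proj (a b x : ℝ) : ℝ := min (max x a) b

/-- The payment `z` of an agent bidding `b`: the competing bid `d^γ` if it wins, else `0`. -/
def payment (b : ℝ) (d : ℝ × ℝ) : ℝ := if d.1 < b then d.1 else 0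

/-- The `(γ+1)`-th highest of all bids when the agent bids `b`. -/
def price (b : ℝ) (d : ℝ × ℝ) : ℝ :=
  if d.1 < b then d.1 else if d.2 < b then b else d.2

/-- The karma gain `g = (γ / N) * price`. -/
def gain (A : Auction) (b : ℝ) (d : ℝ × ℝ) : ℝ := (A.γ : ℝ) / A.N * price b d

/-- The cost `v * (1 - Δ * 1{b > d^γ})` of one period. -/
def cost (A : Auction) (v b : ℝ) (d : ℝ × ℝ) : ℝ :=
  v * (1 - A.Δ * (if d.1 < b then 1 else 0))

/-! ### Adaptive karma pacing

Periods are counted from `0`: index `t` below is the period `t + 1` of the horizon `1, …, T`. -/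

/-- The bid of the strategy, given the multiplier `μ`, the budget `k` and the valuation `v`. -/
def bid (A : Auction) (I : Input) (μ k v : ℝ) : ℝ := min (A.Δ * v / proj I.lo I.hi μ) k

/-- The pair (multiplier, budget) at the beginning of each period, along the path `ω`. -/
def state (A : Auction) (I : Input) (ω : ℕ → Sample) : ℕ → ℝ × ℝ
  | 0 => (I.μ₁, I.k₁)
  | t + 1 =>
    let s := state A I ω t
    let b := bid A I s.1 s.2 (ω t).1
    let z := payment b (ω t).2
    let g := gain A b (ω t).2
    (s.1 + I.ε * (z - g), s.2 - z + g)

/-- The multiplier of the strategy at the beginning of a period. -/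
def mult (A : Auction) (I : Input) (ω : ℕ → Sample) (t : ℕ) : ℝ := (state A I ω t).1

/-- The karma budget at the beginning of a period. -/
def budget (A : Auction) (I : Input) (ω : ℕ → Sample) (t : ℕ) : ℝ := (state A I ω t).2

/-- Total cost of adaptive karma pacing over `T` periods on the sample path `ω`. -/
def pacingCost (A : Auction) (I : Input) (T : ℕ) (ω : ℕ → Sample) : ℝ :=
  ∑ t ∈ Finset.range T,
    cost A (ω t).1 (bid A I (mult A I ω t) (budget A I ω t) (ω t).1) (ω t).2

/-- The largest `n ≤ T` such that `p` holds in each of the first `n` periods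
(`0` if `p` fails in the very first period). -/
def lastTime (T : ℕ) (p : ℕ → Prop) : ℕ := sSup {n : ℕ | n ≤ T ∧ ∀ s < n, p s}

/-- The hitting time: the minimum of the times until which the budget is at least `Δ / lo`,
the multiplier is at least `lo`, and the multiplier is at most `hi`. -/
def hittingTime (A : Auction) (I : Input) (T : ℕ) (ω : ℕ → Sample) : ℕ :=
  min (lastTime T fun s => A.Δ / I.lo ≤ budget A I ω s)
    (min (lastTime T fun s => I.lo ≤ mult A I ω s) (lastTime T fun s => mult A I ω s ≤ I.hi))

/-! ### The benefit of hindsight -/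

/-- A nonnegative bid sequence is feasible if in each period the total payments so far do not
exceed the initial budget plus the gains of the earlier periods. -/
def Feasible (A : Auction) (k₁ : ℝ) (T : ℕ) (ω : ℕ → Sample) (b : ℕ → ℝ) : Prop :=
  (∀ t < T, 0 ≤ b t) ∧
    ∀ s < T, ∑ t ∈ Finset.range (s + 1), payment (b t) (ω t).2
      ≤ k₁ + ∑ t ∈ Finset.range s, gain A (b t) (ω t).2

/-- The optimal cost with the benefit of hindsight on the sample path `ω`. -/
def hindsightCost (A : Auction) (k₁ : ℝ) (T : ℕ) (ω : ℕ → Sample) : ℝ :=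
  sInf {c : ℝ | ∃ b : ℕ → ℝ, Feasible A k₁ T ω b ∧
    c = ∑ t ∈ Finset.range T, cost A (ω t).1 (b t) (ω t).2}

/-- Regret of adaptive karma pacing against the optimal cost in hindsight on the path `ω`. -/
def regret (A : Auction) (I : Input) (T : ℕ) (ω : ℕ → Sample) : ℝ :=
  pacingCost A I T ω - hindsightCost A I.k₁ T ω

/-! ### Stationary competition -/

/-- Law of the sample path: valuations drawn from `V`, competing bids drawn from `D`,
independently of each other and across time. -/
def pathLaw (V : Measure ℝ) (D : Measure (ℝ × ℝ)) [IsProbabilityMeasure V]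
    [IsProbabilityMeasure D] : Measure (ℕ → Sample) :=
  Measure.infinitePi fun _ : ℕ => V.prod D

/-- Average expected regret over `T` periods. -/
def avgRegret (A : Auction) (V : Measure ℝ) (D : Measure (ℝ × ℝ)) [IsProbabilityMeasure V]
    [IsProbabilityMeasure D] (I : Input) (T : ℕ) : ℝ :=
  1 / (T : ℝ) * ∫ ω, regret A I T ω ∂(pathLaw V D)

/-- Expected expenditure at the fixed multiplier `μ`. -/
def expenditure (A : Auction) (V : Measure ℝ) (D : Measure (ℝ × ℝ)) (μ : ℝ) : ℝ :=
  ∫ x : Sample, (if μ * x.2.1 < A.Δ * x.1 then x.2.1 else 0) ∂(V.prod D)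

/-- Expected gain at the fixed multiplier `μ`, with bid `Δ v / μ`. -/
def expectedGain (A : Auction) (V : Measure ℝ) (D : Measure (ℝ × ℝ)) (μ : ℝ) : ℝ :=
  ∫ x : Sample, gain A (A.Δ * x.1 / μ) x.2 ∂(V.prod D)

/-- Expected karma loss at the fixed multiplier `μ`. -/
def karmaLoss (A : Auction) (V : Measure ℝ) (D : Measure (ℝ × ℝ)) (μ : ℝ) : ℝ :=
  expenditure A V D μ - expectedGain A V D μ

/-- Expected dual objective at the fixed multiplier `μ`. -/
def dualObjective (A : Auction) (V : Measure ℝ) (D : Measure (ℝ × ℝ)) (μ : ℝ) : ℝ :=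
  ∫ x : Sample, (x.1 - μ * gain A (A.Δ * x.1 / μ) x.2 - max (A.Δ * x.1 - μ * x.2.1) 0)
    ∂(V.prod D)

/-- Residual gain `(γ / N) * E[d^γ - d^{γ+1}]`. -/
def residualGain (A : Auction) (D : Measure (ℝ × ℝ)) : ℝ :=
  (A.γ : ℝ) / A.N * ∫ d : ℝ × ℝ, (d.1 - d.2) ∂D

/-- Standing assumptions of the model: `0 < Δ ≤ 1`, `1 ≤ γ ≤ N - 1`, the valuation lies in
`[0, 1]` and has a density bounded by `νbar`, and the competing bids are nonnegative with the
`(γ+1)`-th highest at most the `γ`-th highest. -/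
structure IsModel (A : Auction) (V : Measure ℝ) (D : Measure (ℝ × ℝ)) (νbar : ℝ) : Prop where
  Δ_pos : 0 < A.Δ
  Δ_le_one : A.Δ ≤ 1
  one_le_γ : 1 ≤ A.γ
  γ_lt_N : A.γ < A.N
  density : ∃ f : ℝ → ℝ, Measurable f ∧ (∀ x, 0 ≤ f x ∧ f x ≤ νbar) ∧
    V = (volume.restrict (Set.Icc 0 1)).withDensity fun x => ENNReal.ofReal (f x)
  bids : ∀ᵐ d ∂D, 0 ≤ d.2 ∧ d.2 ≤ d.1

/-- Differentiability and strong monotonicity, with the stationary multiplier `μs`.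

Everything is required on the interval `[lo, hi]` of multipliers only. Strong decrease is
required about the stationary multiplier: since `L μs = 0`, the inequality says
`(L μ - L μs) * (μ - μs) ≤ -lam * (μ - μs)^2`, which follows from strong decrease of `L` on all
of `[lo, hi]`; unlike the latter, it allows `L` to be constant near the ends of `[lo, hi]`, as it
has to be when the agent always wins near `lo` or always loses near `hi`. -/
structure HasRegularity (A : Auction) (V : Measure ℝ) (D : Measure (ℝ × ℝ))
    (lo hi lam Z₁ Z₂ G₁ G₂ μs : ℝ) : Prop where
  dual_deriv : ∀ μ ∈ Set.Icc lo hi,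
    HasDerivAt (dualObjective A V D)
      (karmaLoss A V D μ - μ * deriv (expectedGain A V D) μ) μ
  Z_diff : ∀ μ ∈ Set.Icc lo hi, DifferentiableAt ℝ (expenditure A V D) μ ∧
    DifferentiableAt ℝ (deriv (expenditure A V D)) μ
  G_diff : ∀ μ ∈ Set.Icc lo hi, DifferentiableAt ℝ (expectedGain A V D) μ ∧
    DifferentiableAt ℝ (deriv (expectedGain A V D)) μ
  Z_bound : ∀ μ ∈ Set.Icc lo hi, |deriv (expenditure A V D) μ| ≤ Z₁ ∧
    |deriv (deriv (expenditure A V D)) μ| ≤ Z₂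
  G_bound : ∀ μ ∈ Set.Icc lo hi, |deriv (expectedGain A V D) μ| ≤ G₁ ∧
    |deriv (deriv (expectedGain A V D)) μ| ≤ G₂
  stationary : karmaLoss A V D μs = 0
  strong_decrease : ∀ μ ∈ Set.Icc lo hi,
    karmaLoss A V D μ * (μ - μs) ≤ -lam * (μ - μs) ^ 2

/-- Parameter design for the horizon `T`. -/
structure IsAdmissible (A : Auction) (D : Measure (ℝ × ℝ)) (I : Input) (T : ℕ)
    (lam Z₁ G₁ μs : ℝ) : Prop where
  lo_pos : 0 < I.lo
  μ₁_mem : I.μ₁ ∈ Set.Icc I.lo I.hi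
  lo_lt : I.lo < μs
  lt_hi : μs < I.hi
  support : ∀ᵐ d ∂D, d.1 ∈ Set.Icc 0 (A.Δ / I.lo) ∧ d.2 ∈ Set.Icc 0 (A.Δ / I.lo)
  rate_pos : 0 < I.k₁ / T
  rate_lt : I.k₁ / T < (1 - (A.γ : ℝ) / A.N) * ∫ d : ℝ × ℝ, d.1 ∂D
  ε_pos : 0 < I.ε
  ε_le : I.ε ≤ min (1 / (2 * lam)) (1 / (Z₁ + G₁))

/-- Bounds on the supports of valuations and competing bids used to control the hitting time. -/
structure HasSupportBounds (V : Measure ℝ) (D : Measure (ℝ × ℝ)) (vlo dlo dhi : ℝ) : Prop where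
  vlo_pos : 0 < vlo
  vlo_lt : vlo < 1
  dlo_pos : 0 < dlo
  dlo_lt : dlo < dhi
  valuation : ∀ᵐ v ∂V, v ∈ Set.Icc vlo 1
  bids : ∀ᵐ d ∂D, d.1 ∈ Set.Icc dlo dhi ∧ d.2 ∈ Set.Icc dlo dhi

/-- Conditions on the inputs used to control the hitting time. -/
structure ControlsHitting (A : Auction) (I : Input) (vlo dlo dhi : ℝ) : Prop where
  lo_lt : I.lo < A.Δ * vlo / dhi ^ 2
  lt_hi : A.Δ / dlo < I.hi
  ε_lt : I.ε < min (A.Δ * vlo / dhi ^ 2 - I.lo) (1 / dhi * (I.hi - A.Δ / dlo))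
  lt_k₁ : (I.hi - I.μ₁) / I.ε + A.Δ / I.lo < I.k₁

end

end KarmaPacing

open KarmaPacing

/-! Both costs are compared with `T` times the expected cost per period of bidding with the fixed
multiplier μ⋆ and no budget limit. Since L(μ⋆) = 0, this cost is Ψ⁰(μ⋆).

Upper side. The expected cost at a fixed multiplier is c(μ) = Ψ⁰(μ) - μL(μ), with derivative
-μZ'(μ). It need not be stationary at μ⋆, but L'(μ⋆) ≤ -λ, so subtracting a suitable multiple ρL
removes the first-order term: c(q) - c(μ⋆) = ρL(q) + O((q - μ⋆)²)
(`HasRegularity.exists_abs_expectedCost_sub_le`). The update is stochastic approximation whose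
conditional drift, while the budget does not bind, is ε times L at the projected multiplier. Hence
the sum of the E[L] telescopes to the total drift divided by ε (`sum_integral_karmaLoss`), and
expanding the squared distance to μ⋆ bounds the sum of the squared errors
(`integral_sq_add_sum_le`). Both sums are O(1/ε + εT). The multiplier is frozen once the budget
falls below Δ/`lo`; each later period costs at most 1 more. Leaving the multiplier interval does no
harm in this estimate, because the projected force still points towards μ⋆ (`sub_mul_proj_le`).

Lower side. Weak duality with the multiplier μ⋆ bounds the optimum in hindsight
(`sub_le_hindsightCost`). Hindsight bids may earn the full gain (γ/N)d^γ in every period, whereas Ψ⁰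
uses the gain of pacing; the difference is at most μ⋆ times the residual gain.

Limit. The quantity μ + εk is conserved, so a multiplier below its upper bound keeps the budget
large. The support conditions confine the multiplier from above, and the average pacing cost tends
to Ψ⁰(μ⋆). With zero budget the expected optimum is subadditive in the horizon, so its average
converges by Fekete's lemma; a budget o(T) does not change the limit. The limit of the regret is
nonnegative because pacing is itself feasible. -/

namespace KarmaPacing

/-! ### One period -/

/-- A sample with valuation in `[0, 1]` and ordered competing bids in `[0, B]`. -/
structure GoodSample (B : ℝ) (x : Sample) : Prop where
  val_nonneg : 0 ≤ x.1
  val_le : x.1 ≤ 1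
  snd_nonneg : 0 ≤ x.2.2
  snd_le : x.2.2 ≤ x.2.1
  fst_le : x.2.1 ≤ B

theorem GoodSample.fst_nonneg {B : ℝ} {x : Sample} (h : GoodSample B x) : 0 ≤ x.2.1 :=
  h.snd_nonneg.trans h.snd_le

/-- The time saving lies in `(0, 1]`, and the redistributed share of the price in `[0, 1]`. -/
structure Auction.IsProper (A : Auction) : Prop where
  Δ_pos : 0 < A.Δ
  Δ_le_one : A.Δ ≤ 1
  share_nonneg : 0 ≤ (A.γ : ℝ) / A.N
  share_le_one : (A.γ : ℝ) / A.N ≤ 1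

theorem IsModel.isProper {A : Auction} {V : Measure ℝ} {D : Measure (ℝ × ℝ)} {νbar : ℝ}
    (h : IsModel A V D νbar) : A.IsProper := by
  refine ⟨h.Δ_pos, h.Δ_le_one, by positivity, ?_⟩
  refine div_le_one_of_le₀ ?_ (Nat.cast_nonneg _)
  exact_mod_cast h.γ_lt_N.le

theorem payment_nonneg {b : ℝ} {d : ℝ × ℝ} (h : 0 ≤ d.1) : 0 ≤ payment b d := by
  unfold payment; split_ifs <;> simp [h]

theorem payment_le {b : ℝ} {d : ℝ × ℝ} (h : 0 ≤ d.1) : payment b d ≤ d.1 := by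
  unfold payment; split_ifs <;> simp [h]

theorem price_le {b : ℝ} {d : ℝ × ℝ} (h : d.2 ≤ d.1) : price b d ≤ d.1 := by
  unfold price; split_ifs <;> linarith

theorem le_price {b : ℝ} {d : ℝ × ℝ} (h : d.2 ≤ d.1) : d.2 ≤ price b d := by
  unfold price; split_ifs <;> linarith

theorem gain_le {A : Auction} (hA : A.IsProper) {b : ℝ} {d : ℝ × ℝ} (h : d.2 ≤ d.1) :
    gain A b d ≤ (A.γ : ℝ) / A.N * d.1 :=
  mul_le_mul_of_nonneg_left (price_le h) hA.share_nonneg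

theorem le_gain {A : Auction} (hA : A.IsProper) {b : ℝ} {d : ℝ × ℝ} (h : d.2 ≤ d.1) :
    (A.γ : ℝ) / A.N * d.2 ≤ gain A b d :=
  mul_le_mul_of_nonneg_left (le_price h) hA.share_nonneg

theorem gain_nonneg {A : Auction} (hA : A.IsProper) {b : ℝ} {d : ℝ × ℝ} (h0 : 0 ≤ d.2)
    (h : d.2 ≤ d.1) : 0 ≤ gain A b d :=
  (mul_nonneg hA.share_nonneg h0).trans (le_gain hA h)

theorem gain_le_fst {A : Auction} (hA : A.IsProper) {b : ℝ} {d : ℝ × ℝ} (h0 : 0 ≤ d.2)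
    (h : d.2 ≤ d.1) : gain A b d ≤ d.1 :=
  (gain_le hA h).trans (mul_le_of_le_one_left (h0.trans h) hA.share_le_one)

theorem payment_sub_gain_le {A : Auction} (hA : A.IsProper) {b : ℝ} {d : ℝ × ℝ} (h0 : 0 ≤ d.2)
    (h : d.2 ≤ d.1) : payment b d - gain A b d ≤ d.1 := by
  have := payment_le (b := b) (h0.trans h)
  have := gain_nonneg hA (b := b) h0 h
  linarith

theorem neg_le_payment_sub_gain {A : Auction} (hA : A.IsProper) {b : ℝ} {d : ℝ × ℝ} (h0 : 0 ≤ d.2)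
    (h : d.2 ≤ d.1) : -d.1 ≤ payment b d - gain A b d := by
  have := payment_nonneg (b := b) (h0.trans h)
  have := gain_le_fst hA (b := b) h0 h
  linarith

/-- At most the whole payment is redistributed to the winner, so a win never lowers the multiplier.
With the next lemma, this fixes the sign of a step near the ends of the multiplier interval. -/
theorem payment_sub_gain_nonneg_of_win {A : Auction} (hA : A.IsProper) {b : ℝ} {d : ℝ × ℝ}
    (h0 : 0 ≤ d.1) (hb : d.1 < b) : 0 ≤ payment b d - gain A b d := by
  simp only [payment, gain, price, hb, if_true]
  have := mul_le_of_le_one_left h0 hA.share_le_one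
  linarith

theorem payment_sub_gain_nonpos_of_lose {A : Auction} (hA : A.IsProper) {b : ℝ} {d : ℝ × ℝ}
    (h0 : 0 ≤ d.2) (h : d.2 ≤ d.1) (hb : b ≤ d.1) : payment b d - gain A b d ≤ 0 := by
  have := gain_nonneg hA (b := b) h0 h
  simp only [payment, not_lt.2 hb, if_false]
  linarith

theorem cost_nonneg {A : Auction} (hA : A.IsProper) {v b : ℝ} {d : ℝ × ℝ} (hv : 0 ≤ v) :
    0 ≤ cost A v b d := by
  have h0 := hA.Δ_pos
  have h1 := hA.Δ_le_one
  unfold cost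
  split_ifs
  · exact mul_nonneg hv (by linarith)
  · simpa using hv

theorem cost_le {A : Auction} (hA : A.IsProper) {v b : ℝ} {d : ℝ × ℝ} (hv : 0 ≤ v) :
    cost A v b d ≤ v := by
  have h0 := hA.Δ_pos
  unfold cost
  split_ifs
  · nlinarith [mul_nonneg hv h0.le]
  · simp

theorem measurable_payment : Measurable fun p : ℝ × (ℝ × ℝ) => payment p.1 p.2 := by
  unfold payment
  exact Measurable.ite (measurableSet_lt (by fun_prop) (by fun_prop)) (by fun_prop) (by fun_prop)

theorem measurable_gain (A : Auction) : Measurable fun p : ℝ × (ℝ × ℝ) => gain A p.1 p.2 := by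
  unfold gain price
  refine measurable_const.mul ?_
  exact Measurable.ite (measurableSet_lt (by fun_prop) (by fun_prop)) (by fun_prop)
    (Measurable.ite (measurableSet_lt (by fun_prop) (by fun_prop)) (by fun_prop) (by fun_prop))

theorem measurable_cost (A : Auction) :
    Measurable fun p : ℝ × ℝ × (ℝ × ℝ) => cost A p.1 p.2.1 p.2.2 := by
  unfold cost
  refine measurable_fst.mul (measurable_const.sub (measurable_const.mul ?_))
  exact Measurable.ite (measurableSet_lt (by fun_prop) (by fun_prop)) (by fun_prop) (by fun_prop)

theorem measurable_proj (a b : ℝ) : Measurable (proj a b) := by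
  unfold proj; fun_prop

theorem proj_mem {a b : ℝ} (hab : a ≤ b) (x : ℝ) : proj a b x ∈ Set.Icc a b :=
  ⟨le_min (le_max_right _ _) hab, min_le_right _ _⟩

theorem proj_of_mem {a b x : ℝ} (hx : x ∈ Set.Icc a b) : proj a b x = x := by
  rw [proj, max_eq_left hx.1, min_eq_left hx.2]

/-- Karma loss in one period when bidding with multiplier `q` and no budget limit. -/
noncomputable def lossAt (A : Auction) (q : ℝ) (x : Sample) : ℝ :=
  payment (A.Δ * x.1 / q) x.2 - gain A (A.Δ * x.1 / q) x.2

/-- Cost of one period when bidding with multiplier `q` and no budget limit. -/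
noncomputable def costAt (A : Auction) (q : ℝ) (x : Sample) : ℝ :=
  cost A x.1 (A.Δ * x.1 / q) x.2

theorem measurable_lossAt (A : Auction) : Measurable fun p : ℝ × Sample => lossAt A p.1 p.2 := by
  unfold lossAt
  have h : Measurable fun p : ℝ × Sample => (A.Δ * p.2.1 / p.1, p.2.2) := by fun_prop
  exact (measurable_payment.comp h).sub ((measurable_gain A).comp h)

theorem measurable_costAt (A : Auction) : Measurable fun p : ℝ × Sample => costAt A p.1 p.2 := by
  unfold costAt
  have h : Measurable fun p : ℝ × Sample => (p.2.1, A.Δ * p.2.1 / p.1, p.2.2) := by fun_prop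
  exact (measurable_cost A).comp h

theorem abs_lossAt_le {A : Auction} (hA : A.IsProper) {B q : ℝ} {x : Sample}
    (hx : GoodSample B x) : |lossAt A q x| ≤ B :=
  abs_le.2 ⟨by
    have := neg_le_payment_sub_gain hA (b := A.Δ * x.1 / q) hx.snd_nonneg hx.snd_le
    have := hx.fst_le
    unfold lossAt; linarith,
    (payment_sub_gain_le hA hx.snd_nonneg hx.snd_le).trans hx.fst_le⟩

theorem costAt_mem {A : Auction} (hA : A.IsProper) {B q : ℝ} {x : Sample}
    (hx : GoodSample B x) : costAt A q x ∈ Set.Icc 0 1 :=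
  ⟨cost_nonneg hA hx.val_nonneg, (cost_le hA hx.val_nonneg).trans hx.val_le⟩

/-! ### Calculus around the stationary multiplier -/

/-- First-order Taylor expansion with a quadratic remainder. -/
theorem abs_sub_linear_le {f f' f'' : ℝ → ℝ} {lo hi M : ℝ}
    (hf : ∀ x ∈ Set.Icc lo hi, HasDerivAt f (f' x) x)
    (hf' : ∀ x ∈ Set.Icc lo hi, HasDerivAt f' (f'' x) x)
    (hM : ∀ x ∈ Set.Icc lo hi, |f'' x| ≤ M) {a x : ℝ} (ha : a ∈ Set.Icc lo hi)
    (hx : x ∈ Set.Icc lo hi) : |f x - f a - f' a * (x - a)| ≤ M * (x - a) ^ 2 := by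
  have hsub : Set.uIcc a x ⊆ Set.Icc lo hi := Set.uIcc_subset_Icc ha hx
  have hM0 : 0 ≤ M := (abs_nonneg _).trans (hM a ha)
  -- The mean value inequality is used twice: for `f'` here, then for `f` minus its tangent. The
  -- factor 1/2 of Taylor's formula is given up.
  have hlip : ∀ y ∈ Set.uIcc a x, |f' y - f' a| ≤ M * |x - a| := by
    intro y hy
    have h := (convex_Icc lo hi).norm_image_sub_le_of_norm_hasDerivWithin_le
      (f := f') (f' := f'') (C := M) (fun z hz => (hf' z hz).hasDerivWithinAt)
      (fun z hz => hM z hz) ha (hsub hy)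
    refine h.trans (mul_le_mul_of_nonneg_left ?_ hM0)
    exact Set.abs_sub_left_of_mem_uIcc hy
  have h := (convex_uIcc a x).norm_image_sub_le_of_norm_hasDerivWithin_le
    (f := fun y => f y - f' a * y) (f' := fun y => f' y - f' a) (C := M * |x - a|)
    (fun y hy => by
      have := ((hf y (hsub hy)).sub ((hasDerivAt_id y).const_mul (f' a))).hasDerivWithinAt
        (s := Set.uIcc a x)
      rw [mul_one] at this
      exact this)
    (fun y hy => hlip y hy) Set.left_mem_uIcc Set.right_mem_uIcc
  rw [Real.norm_eq_abs, Real.norm_eq_abs, mul_assoc, ← sq, sq_abs] at h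
  convert h using 2
  ring

/-- Dividing the decrease condition by (x - a)² bounds every slope to the right of `a` by `-lam`;
the derivative is their limit. -/
theorem deriv_le_of_strong_decrease {L : ℝ → ℝ} {L' lo hi lam a : ℝ} (hL : HasDerivAt L L' a)
    (h0 : L a = 0) (hhi : a < hi) (hlo : lo < a)
    (hdec : ∀ x ∈ Set.Icc lo hi, L x * (x - a) ≤ -lam * (x - a) ^ 2) : L' ≤ -lam := by
  have h := (hasDerivAt_iff_tendsto_slope.1 hL).mono_left
    (nhdsWithin_mono a (fun x (hx : x ∈ Set.Ioi a) => (ne_of_gt hx : x ≠ a)))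
  refine le_of_tendsto h ?_
  filter_upwards [Ioo_mem_nhdsGT hhi] with x hx
  have hxa : 0 < x - a := sub_pos.2 hx.1
  have := hdec x ⟨hlo.le.trans hx.1.le, hx.2.le⟩
  rw [slope_def_field, h0, sub_zero, div_le_iff₀ hxa]
  nlinarith

/-- Expected cost at a fixed multiplier, in terms of the dual objective. -/
noncomputable def expectedCost (A : Auction) (V : Measure ℝ) (D : Measure (ℝ × ℝ)) (μ : ℝ) : ℝ :=
  dualObjective A V D μ - μ * karmaLoss A V D μ

/-- Up to a multiple of the karma loss, the expected cost is stationary at `μs` to second order. -/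
theorem HasRegularity.exists_abs_expectedCost_sub_le {A : Auction} {V : Measure ℝ}
    {D : Measure (ℝ × ℝ)} {lo hi lam Z₁ Z₂ G₁ G₂ μs : ℝ}
    (h : HasRegularity A V D lo hi lam Z₁ Z₂ G₁ G₂ μs) (hlo : 0 < lo) (hlam : 0 < lam)
    (h1 : lo < μs) (h2 : μs < hi) :
    ∃ ρ : ℝ, |ρ| ≤ hi * Z₁ / lam ∧ ∀ q ∈ Set.Icc lo hi,
      |expectedCost A V D q - expectedCost A V D μs - ρ * karmaLoss A V D q|
        ≤ (Z₁ + hi * Z₂ + hi * Z₁ / lam * (Z₂ + G₂)) * (q - μs) ^ 2 := by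
  have hs : μs ∈ Set.Icc lo hi := ⟨h1.le, h2.le⟩
  set Z := expenditure A V D with hZ
  set G := expectedGain A V D with hG
  set L := karmaLoss A V D with hL
  have hLd : ∀ q ∈ Set.Icc lo hi, HasDerivAt L (deriv Z q - deriv G q) q := fun q hq =>
    (h.Z_diff q hq).1.hasDerivAt.sub (h.G_diff q hq).1.hasDerivAt
  have hLdd : ∀ q ∈ Set.Icc lo hi, HasDerivAt (fun q => deriv Z q - deriv G q)
      (deriv (deriv Z) q - deriv (deriv G) q) q := fun q hq =>
    (h.Z_diff q hq).2.hasDerivAt.sub (h.G_diff q hq).2.hasDerivAt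
  -- In (Ψ⁰ - qL)' = (L - qG') - L - q(Z' - G') everything but -qZ' cancels.
  have hCd : ∀ q ∈ Set.Icc lo hi, HasDerivAt (expectedCost A V D) (-(q * deriv Z q)) q := by
    intro q hq
    have := (h.dual_deriv q hq).sub ((hasDerivAt_id q).mul (hLd q hq))
    refine this.congr_deriv ?_
    simp only [id_eq]
    ring
  have hCdd : ∀ q ∈ Set.Icc lo hi, HasDerivAt (fun q => -(q * deriv Z q))
      (-(1 * deriv Z q + q * deriv (deriv Z) q)) q := fun q hq =>
    ((hasDerivAt_id q).mul (h.Z_diff q hq).2.hasDerivAt).neg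
  have hL' : deriv Z μs - deriv G μs ≤ -lam :=
    deriv_le_of_strong_decrease (hLd μs hs) h.stationary h2 h1 h.strong_decrease
  set L' := deriv Z μs - deriv G μs with hL'def
  have hL'0 : L' ≠ 0 := (hL'.trans_lt (neg_lt_zero.2 hlam)).ne
  have hZ1 : 0 ≤ Z₁ := (abs_nonneg _).trans (h.Z_bound μs hs).1
  have hρ : |-(μs * deriv Z μs) / L'| ≤ hi * Z₁ / lam := by
    rw [abs_div, abs_neg, abs_mul, abs_of_pos (hlo.trans h1)]
    refine div_le_div₀ (by nlinarith) ?_ hlam ?_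
    · exact mul_le_mul h2.le (h.Z_bound μs hs).1 (abs_nonneg _) (by linarith)
    · rw [abs_of_neg (by linarith)]; linarith
  -- The witness is the ratio of the derivatives of the expected cost and of the karma loss at `μs`,
  -- so that the linear terms of the two expansions cancel.
  refine ⟨-(μs * deriv Z μs) / L', hρ, fun q hq => ?_⟩
  have hc := abs_sub_linear_le hCd hCdd (M := Z₁ + hi * Z₂) (fun x hx => by
    rw [abs_neg]
    refine (abs_add_le _ _).trans (add_le_add (by simpa using (h.Z_bound x hx).1) ?_)
    rw [abs_mul, abs_of_pos (hlo.trans_le hx.1)]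
    exact mul_le_mul hx.2 (h.Z_bound x hx).2 (abs_nonneg _) (by linarith)) hs hq
  have hl := abs_sub_linear_le hLd hLdd (M := Z₂ + G₂) (fun x hx =>
    (abs_sub _ _).trans (add_le_add (h.Z_bound x hx).2 (h.G_bound x hx).2)) hs hq
  rw [show L μs = 0 from h.stationary, sub_zero] at hl
  have hl' := mul_le_mul hρ hl (abs_nonneg _) ((abs_nonneg _).trans hρ)
  rw [← abs_mul] at hl'
  have key : expectedCost A V D q - expectedCost A V D μs - -(μs * deriv Z μs) / L' * L q
      = (expectedCost A V D q - expectedCost A V D μs - -(μs * deriv Z μs) * (q - μs))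
        - -(μs * deriv Z μs) / L' * (L q - L' * (q - μs)) := by
    field_simp
    ring
  rw [key]
  refine (abs_sub _ _).trans ((add_le_add hc hl').trans (le_of_eq (by ring)))

/-! ### The optimum in hindsight on one path -/

/-- The bid sequence that wins exactly in `S` and bids the highest losing amount otherwise. -/
noncomputable def selectionBid (ω : ℕ → Sample) (S : Finset ℕ) (t : ℕ) : ℝ :=
  if t ∈ S then (ω t).2.1 + 1 else (ω t).2.1

theorem payment_selectionBid (ω : ℕ → Sample) (S : Finset ℕ) (t : ℕ) :
    payment (selectionBid ω S t) (ω t).2 = if t ∈ S then (ω t).2.1 else 0 := by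
  unfold payment selectionBid
  split_ifs <;> first | rfl | (exfalso; linarith)

theorem cost_selectionBid (A : Auction) (ω : ℕ → Sample) (S : Finset ℕ) (t : ℕ) (v : ℝ) :
    cost A v (selectionBid ω S t) (ω t).2 = v * (1 - A.Δ * if t ∈ S then 1 else 0) := by
  unfold cost selectionBid
  split_ifs <;> first | rfl | (exfalso; linarith)

theorem price_of_ge {b : ℝ} {d : ℝ × ℝ} (h : d.2 ≤ d.1) (hb : d.1 ≤ b) : price b d = d.1 := by
  unfold price; split_ifs <;> linarith

theorem gain_selectionBid (A : Auction) {ω : ℕ → Sample} (S : Finset ℕ) {t : ℕ}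
    (h : (ω t).2.2 ≤ (ω t).2.1) :
    gain A (selectionBid ω S t) (ω t).2 = (A.γ : ℝ) / A.N * (ω t).2.1 := by
  unfold gain
  rw [price_of_ge h]
  unfold selectionBid
  split_ifs <;> linarith

/-- The wins in `S` can be afforded when every period earns the largest possible gain. -/
def Affordable (A : Auction) (k : ℝ) (T : ℕ) (ω : ℕ → Sample) (S : Finset ℕ) : Prop :=
  ∀ s ∈ Finset.range T, ∑ t ∈ Finset.range (s + 1), (if t ∈ S then (ω t).2.1 else 0)
    ≤ k + ∑ t ∈ Finset.range s, (A.γ : ℝ) / A.N * (ω t).2.1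

open Classical in
/-- Total cost of winning exactly in `S`, or of never winning if `S` is not affordable. -/
noncomputable def selectionCost (A : Auction) (k : ℝ) (T : ℕ) (S : Finset ℕ) (ω : ℕ → Sample) :
    ℝ :=
  if Affordable A k T ω S then
    ∑ t ∈ Finset.range T, (ω t).1 * (1 - A.Δ * if t ∈ S then 1 else 0)
  else ∑ t ∈ Finset.range T, (ω t).1

theorem bddBelow_feasible_cost {A : Auction} (hA : A.IsProper) (k : ℝ) {T : ℕ} {ω : ℕ → Sample}
    (hv : ∀ t, 0 ≤ (ω t).1) :
    BddBelow {c : ℝ | ∃ b : ℕ → ℝ, Feasible A k T ω b ∧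
      c = ∑ t ∈ Finset.range T, cost A (ω t).1 (b t) (ω t).2} := by
  refine ⟨0, ?_⟩
  rintro _ ⟨b, -, rfl⟩
  exact Finset.sum_nonneg fun t _ => cost_nonneg hA (hv t)

theorem hindsightCost_le {A : Auction} (hA : A.IsProper) {k : ℝ} {T : ℕ} {ω : ℕ → Sample}
    (hv : ∀ t, 0 ≤ (ω t).1) {b : ℕ → ℝ} (hb : Feasible A k T ω b) :
    hindsightCost A k T ω ≤ ∑ t ∈ Finset.range T, cost A (ω t).1 (b t) (ω t).2 :=
  csInf_le (bddBelow_feasible_cost hA k hv) ⟨b, hb, rfl⟩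

section

variable {A : Auction} {B : ℝ} {ω : ℕ → Sample}

theorem feasible_selectionBid (hω : ∀ t, GoodSample B (ω t)) {k : ℝ} {T : ℕ} {S : Finset ℕ}
    (hS : Affordable A k T ω S) : Feasible A k T ω (selectionBid ω S) := by
  refine ⟨fun t _ => ?_, fun s hs => ?_⟩
  · have := (hω t).fst_nonneg
    unfold selectionBid; split_ifs <;> linarith
  · simp only [payment_selectionBid, gain_selectionBid A S (hω _).snd_le]
    exact hS s (Finset.mem_range.2 hs)

theorem affordable_empty (hA : A.IsProper) (hω : ∀ t, GoodSample B (ω t)) {k : ℝ} (hk : 0 ≤ k)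
    (T : ℕ) : Affordable A k T ω ∅ := by
  intro s _
  simp only [Finset.notMem_empty, if_false, Finset.sum_const_zero]
  exact add_nonneg hk (Finset.sum_nonneg fun t _ => mul_nonneg hA.share_nonneg (hω t).fst_nonneg)

theorem feasible_cost_nonempty (hA : A.IsProper) (hω : ∀ t, GoodSample B (ω t)) {k : ℝ}
    (hk : 0 ≤ k) (T : ℕ) : {c : ℝ | ∃ b : ℕ → ℝ, Feasible A k T ω b ∧
      c = ∑ t ∈ Finset.range T, cost A (ω t).1 (b t) (ω t).2}.Nonempty :=
  ⟨_, _, feasible_selectionBid hω (affordable_empty hA hω hk T), rfl⟩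

theorem hindsightCost_le_selectionCost (hA : A.IsProper) (hω : ∀ t, GoodSample B (ω t)) {k : ℝ}
    (hk : 0 ≤ k) {T : ℕ} (S : Finset ℕ) :
    hindsightCost A k T ω ≤ selectionCost A k T S ω := by
  unfold selectionCost
  split_ifs with h
  · refine (hindsightCost_le hA (fun t => (hω t).val_nonneg) (feasible_selectionBid hω h)).trans ?_
    simp only [cost_selectionBid, le_refl]
  · refine (hindsightCost_le hA (fun t => (hω t).val_nonneg)
      (feasible_selectionBid hω (affordable_empty hA hω hk T))).trans ?_
    simp [cost_selectionBid]

/-- Cost and payments depend on the bids only through the set of wins, and raising each losing bid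
to d^γ maximizes the gain without winning. So only finitely many candidates matter, which is what
makes the optimum measurable in the path. -/
theorem hindsightCost_eq_inf' (hA : A.IsProper) (hω : ∀ t, GoodSample B (ω t)) {k : ℝ}
    (hk : 0 ≤ k) (T : ℕ) :
    hindsightCost A k T ω = (Finset.range T).powerset.inf' ⟨∅, by simp⟩
      (fun S => selectionCost A k T S ω) := by
  classical
  refine le_antisymm (Finset.le_inf' _ _ fun S _ => hindsightCost_le_selectionCost hA hω hk S) ?_
  refine le_csInf (feasible_cost_nonempty hA hω hk T) ?_
  rintro _ ⟨b, hb, rfl⟩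
  set S := (Finset.range T).filter fun t => (ω t).2.1 < b t with hSdef
  have hmem : ∀ t ∈ Finset.range T, (t ∈ S ↔ (ω t).2.1 < b t) := fun t ht => by
    rw [hSdef, Finset.mem_filter, and_iff_right ht]
  have hS : Affordable A k T ω S := by
    intro s hs
    have hs' := Finset.mem_range.1 hs
    calc ∑ t ∈ Finset.range (s + 1), (if t ∈ S then (ω t).2.1 else 0)
        = ∑ t ∈ Finset.range (s + 1), payment (b t) (ω t).2 := by
          refine Finset.sum_congr rfl fun t ht => ?_
          rw [Finset.mem_range] at ht
          simp only [hmem t (Finset.mem_range.2 (by omega)), payment]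
      _ ≤ k + ∑ t ∈ Finset.range s, gain A (b t) (ω t).2 := hb.2 s hs'
      _ ≤ _ := add_le_add le_rfl (Finset.sum_le_sum fun t _ => gain_le hA (hω t).snd_le)
  refine (Finset.inf'_le _ (Finset.mem_powerset.2 (Finset.filter_subset _ _) :
    S ∈ (Finset.range T).powerset)).trans (le_of_eq ?_)
  rw [selectionCost, if_pos hS]
  refine Finset.sum_congr rfl fun t ht => ?_
  simp only [hmem t ht, cost]

theorem hindsightCost_nonneg (hA : A.IsProper) (hω : ∀ t, GoodSample B (ω t)) (k : ℝ) (T : ℕ) :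
    0 ≤ hindsightCost A k T ω := by
  refine Real.sInf_nonneg ?_
  rintro _ ⟨b, -, rfl⟩
  exact Finset.sum_nonneg fun t _ => cost_nonneg hA (hω t).val_nonneg

theorem hindsightCost_le_horizon (hA : A.IsProper) (hω : ∀ t, GoodSample B (ω t)) {k : ℝ}
    (hk : 0 ≤ k) (T : ℕ) : hindsightCost A k T ω ≤ T := by
  refine (hindsightCost_le hA (fun t => (hω t).val_nonneg)
    (feasible_selectionBid hω (affordable_empty hA hω hk T))).trans ?_
  calc _ ≤ ∑ t ∈ Finset.range T, (1 : ℝ) := Finset.sum_le_sum fun t _ =>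
        (cost_le hA (hω t).val_nonneg).trans (hω t).val_le
    _ = T := by simp

/-- Lagrangian lower bound on the cost of a feasible bid sequence. -/
theorem sub_le_hindsightCost (hA : A.IsProper) (hω : ∀ t, GoodSample B (ω t)) {k μ : ℝ}
    (hk : 0 ≤ k) (hμ : 0 ≤ μ) (T : ℕ) :
    ∑ t ∈ Finset.range T, ((ω t).1 - μ * ((A.γ : ℝ) / A.N * (ω t).2.1)
        - max (A.Δ * (ω t).1 - μ * (ω t).2.1) 0) - μ * k ≤ hindsightCost A k T ω := by
  refine le_csInf (feasible_cost_nonempty hA hω hk T) ?_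
  rintro _ ⟨b, hb, rfl⟩
  -- Only the constraint of the last period is used; it omits the gain of that period, which is
  -- nonnegative and may be added.
  have hbudget : ∑ t ∈ Finset.range T, (payment (b t) (ω t).2 - gain A (b t) (ω t).2) ≤ k := by
    rcases T with _ | T
    · simpa using hk
    · have h := hb.2 T (Nat.lt_succ_self T)
      have hg := gain_nonneg hA (b := b T) (hω T).snd_nonneg (hω T).snd_le
      rw [Finset.sum_sub_distrib, Finset.sum_range_succ (fun t => gain A (b t) (ω t).2)]
      linarith
  have hterm : ∀ t ∈ Finset.range T, (ω t).1 - μ * ((A.γ : ℝ) / A.N * (ω t).2.1)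
      - max (A.Δ * (ω t).1 - μ * (ω t).2.1) 0 ≤ cost A (ω t).1 (b t) (ω t).2
        + μ * (payment (b t) (ω t).2 - gain A (b t) (ω t).2) := by
    intro t _
    have hg := mul_le_mul_of_nonneg_left (gain_le hA (b := b t) (hω t).snd_le) hμ
    have h1 := le_max_left (A.Δ * (ω t).1 - μ * (ω t).2.1) 0
    have h2 := le_max_right (A.Δ * (ω t).1 - μ * (ω t).2.1) 0
    unfold cost payment
    split_ifs <;> linarith
  have hsum := Finset.sum_le_sum hterm
  rw [Finset.sum_add_distrib, ← Finset.mul_sum] at hsum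
  have := mul_le_mul_of_nonneg_left hbudget hμ
  linarith

theorem hindsightCost_antitone (hA : A.IsProper) (hω : ∀ t, GoodSample B (ω t)) {k k' : ℝ}
    (hk : 0 ≤ k) (hkk : k ≤ k') (T : ℕ) : hindsightCost A k' T ω ≤ hindsightCost A k T ω := by
  refine le_csInf (feasible_cost_nonempty hA hω hk T) ?_
  rintro _ ⟨b, hb, rfl⟩
  exact hindsightCost_le hA (fun t => (hω t).val_nonneg)
    ⟨hb.1, fun s hs => (hb.2 s hs).trans (by linarith)⟩

/-- With zero initial budget, optimal sequences for consecutive blocks can be concatenated. -/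
theorem hindsightCost_add_le (hA : A.IsProper) (hω : ∀ t, GoodSample B (ω t)) (S T : ℕ) :
    hindsightCost A 0 (S + T) ω
      ≤ hindsightCost A 0 S ω + hindsightCost A 0 T (fun t => ω (S + t)) := by
  rw [← sub_le_iff_le_add']
  refine le_csInf (feasible_cost_nonempty hA (fun t => hω (S + t)) le_rfl T) ?_
  rintro _ ⟨b', hb', rfl⟩
  rw [sub_le_iff_le_add', ← sub_le_iff_le_add]
  refine le_csInf (feasible_cost_nonempty hA hω le_rfl S) ?_
  rintro _ ⟨b, hb, rfl⟩
  rw [sub_le_iff_le_add]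
  set c : ℕ → ℝ := fun t => if t < S then b t else b' (t - S) with hc
  have hc1 : ∀ t, t < S → c t = b t := fun t ht => by simp [hc, ht]
  have hc2 : ∀ t, c (S + t) = b' t := fun t => by simp [hc]
  have split : ∀ (f : ℕ → ℝ → ℝ) (n : ℕ), ∑ t ∈ Finset.range (S + n), f t (c t)
      = ∑ t ∈ Finset.range S, f t (b t) + ∑ t ∈ Finset.range n, f (S + t) (b' t) := by
    intro f n
    rw [Finset.sum_range_add]
    congr 1
    · exact Finset.sum_congr rfl fun t ht => by rw [hc1 t (Finset.mem_range.1 ht)]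
    · exact Finset.sum_congr rfl fun t _ => by rw [hc2]
  -- The first block ends with a nonnegative balance, so the second block can start as if from zero
  -- budget.
  have hfirst : ∑ t ∈ Finset.range S, payment (b t) (ω t).2
      ≤ ∑ t ∈ Finset.range S, gain A (b t) (ω t).2 := by
    rcases S with _ | S
    · simp
    · have h := hb.2 S (Nat.lt_succ_self S)
      have hg := gain_nonneg hA (b := b S) (hω S).snd_nonneg (hω S).snd_le
      rw [Finset.sum_range_succ (fun t => gain A (b t) (ω t).2)]
      linarith
  have hfeas : Feasible A 0 (S + T) ω c := by
    refine ⟨fun t ht => ?_, fun s hs => ?_⟩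
    · rcases lt_or_ge t S with h | h
      · rw [hc1 t h]; exact hb.1 t h
      · obtain ⟨u, rfl⟩ := Nat.exists_eq_add_of_le h
        rw [hc2]; exact hb'.1 u (by omega)
    · rcases lt_or_ge s S with h | h
      · rw [Finset.sum_congr rfl fun t ht => by
            rw [hc1 t (by rw [Finset.mem_range] at ht; omega)],
          Finset.sum_congr rfl (s₁ := Finset.range s) (f := fun t => gain A (c t) (ω t).2)
            fun t ht => by rw [hc1 t (by rw [Finset.mem_range] at ht; omega)]]
        exact hb.2 s h
      · obtain ⟨u, rfl⟩ := Nat.exists_eq_add_of_le h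
        rw [add_assoc, split (fun t x => payment x (ω t).2), split (fun t x => gain A x (ω t).2)]
        have := hb'.2 u (by omega)
        linarith
  refine (hindsightCost_le hA (fun t => (hω t).val_nonneg) hfeas).trans (le_of_eq ?_)
  rw [split (fun t x => cost A (ω t).1 x (ω t).2), add_comm]

/-- An initial budget `k` is worth at most about `k / dlo` wins. -/
theorem hindsightCost_zero_le (hA : A.IsProper) (hω : ∀ t, GoodSample B (ω t)) {dlo : ℝ}
    (hdlo : 0 < dlo) (hd : ∀ t, dlo ≤ (ω t).2.1) {k : ℝ} (hk : 0 ≤ k) (T : ℕ) :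
    hindsightCost A 0 T ω ≤ hindsightCost A k T ω + (k + B) / dlo := by
  rw [← sub_le_iff_le_add]
  refine le_csInf (feasible_cost_nonempty hA hω hk T) ?_
  rintro _ ⟨b, hb, rfl⟩
  rw [sub_le_iff_le_add]
  set z : ℕ → ℝ := fun t => payment (b t) (ω t).2 with hz
  have hz0 : ∀ t, 0 ≤ z t := fun t => payment_nonneg (hω t).fst_nonneg
  set R : ℕ → ℝ := fun t => ∑ s ∈ Finset.range t, z s with hR
  have hRmono : ∀ t, R t ≤ R (t + 1) := fun t => by
    rw [hR]; simp only [Finset.sum_range_succ]; linarith [hz0 t]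
  -- Wins are given up as long as the payments so far are below `k`.
  set c : ℕ → ℝ := fun t => if R t < k then min (b t) (ω t).2.1 else b t with hc
  have hpay : ∀ t, payment (c t) (ω t).2 = if R t < k then 0 else z t := by
    intro t
    simp only [hc]
    split_ifs with h
    · simp [payment]
    · rfl
  -- Lowering a winning bid to d^γ turns it into a loss at the same price, so no gain is forfeited.
  have hgain : ∀ t, gain A (c t) (ω t).2 = gain A (b t) (ω t).2 := by
    intro t
    simp only [hc]
    split_ifs with h
    · rcases le_total (b t) (ω t).2.1 with h' | h'
      · rw [min_eq_left h']
      · rw [min_eq_right h', gain, gain, price_of_ge (hω t).snd_le le_rfl,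
          price_of_ge (hω t).snd_le h']
    · rfl
  have hremoved : ∀ n, ∑ t ∈ Finset.range n, payment (c t) (ω t).2 ≤ max 0 (R n - k) := by
    intro n
    induction n with
    | zero => simp
    | succ n ih =>
      rw [Finset.sum_range_succ, hpay]
      split_ifs with h
      · rw [max_eq_left (by linarith)] at ih
        have := le_max_left 0 (R (n + 1) - k)
        linarith
      · rw [max_eq_right (by linarith [not_lt.1 h])] at ih
        refine le_trans ?_ (le_max_right _ _)
        have : R (n + 1) = R n + z n := Finset.sum_range_succ _ _
        linarith
  -- The payments given up start below `k` each time, so they overshoot `k` by at most one payment,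
  -- hence by at most `B`.
  have hcount : ∀ n, ∑ t ∈ Finset.range n, (if R t < k then z t else 0) ≤ k + B := by
    intro n
    have hB : 0 ≤ B := (hω 0).fst_nonneg.trans (hω 0).fst_le
    have : ∀ n, ∑ t ∈ Finset.range n, (if R t < k then z t else 0) ≤ R n ∧
        ∑ t ∈ Finset.range n, (if R t < k then z t else 0) ≤ k + B := by
      intro n
      induction n with
      | zero => simp [hR]; linarith
      | succ n ih =>
        have hRn : R (n + 1) = R n + z n := Finset.sum_range_succ _ _
        have hzB : z n ≤ B := (payment_le (hω n).fst_nonneg).trans (hω n).fst_le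
        rw [Finset.sum_range_succ]
        split_ifs with h
        · exact ⟨by linarith [ih.1], by linarith [ih.1]⟩
        · exact ⟨by linarith [ih.1, hz0 n], by linarith [ih.2]⟩
    exact (this n).2
  have hfeas : Feasible A 0 T ω c := by
    refine ⟨fun t ht => ?_, fun s hs => ?_⟩
    · simp only [hc]
      split_ifs
      · exact le_min (hb.1 t ht) (hω t).fst_nonneg
      · exact hb.1 t ht
    · refine (hremoved _).trans (max_le ?_ ?_)
      · rw [zero_add]
        exact Finset.sum_nonneg fun t _ => gain_nonneg hA (hω t).snd_nonneg (hω t).snd_le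
      · simp only [hgain]
        have := hb.2 s hs
        rw [zero_add]
        exact sub_le_iff_le_add'.2 this
  refine (hindsightCost_le hA (fun t => (hω t).val_nonneg) hfeas).trans ?_
  -- A win given up loses Δv ≤ 1, while its payment is at least `dlo`; payments divided by `dlo`
  -- therefore count these losses.
  have hcost : ∀ t ∈ Finset.range T, cost A (ω t).1 (c t) (ω t).2
      ≤ cost A (ω t).1 (b t) (ω t).2 + (if R t < k then z t else 0) / dlo := by
    intro t _
    simp only [hc]
    split_ifs with h
    · simp only [cost, payment, hz, not_lt.2 (min_le_right (b t) (ω t).2.1), if_false]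
      split_ifs
      · have h1 : 1 ≤ (ω t).2.1 / dlo := (one_le_div hdlo).2 (hd t)
        have h2 : (ω t).1 * A.Δ ≤ 1 :=
          mul_le_one₀ (hω t).val_le hA.Δ_pos.le hA.Δ_le_one
        linarith
      · simp
    · simp
  refine (Finset.sum_le_sum hcost).trans ?_
  rw [Finset.sum_add_distrib, ← Finset.sum_div]
  exact add_le_add le_rfl (div_le_div_of_nonneg_right (hcount T) hdlo.le)

end

theorem measurable_selectionCost (A : Auction) (k : ℝ) (T : ℕ) (S : Finset ℕ) :
    Measurable (selectionCost A k T S) := by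
  classical
  unfold selectionCost
  refine Measurable.ite ?_ (by fun_prop) (by fun_prop)
  have : {ω : ℕ → Sample | Affordable A k T ω S} = ⋂ s ∈ Finset.range T,
      {ω | ∑ t ∈ Finset.range (s + 1), (if t ∈ S then (ω t).2.1 else 0)
        ≤ k + ∑ t ∈ Finset.range s, (A.γ : ℝ) / A.N * (ω t).2.1} := by
    ext ω; simp [Affordable]
  rw [this]
  refine Finset.measurableSet_biInter _ fun s _ => measurableSet_le ?_ (by fun_prop)
  refine Finset.measurable_fun_sum _ fun t _ => ?_
  split_ifs <;> fun_prop

/-! ### Independent and identically distributed sequences -/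

section

variable {X : Type*} [MeasurableSpace X] (ν : Measure X) [IsProbabilityMeasure ν]

/-- A function of the first `t` coordinates is independent of the coordinate `t`. -/
theorem map_prodMk_infinitePi [Inhabited X] {E : Type*} [MeasurableSpace E] {F : (ℕ → X) → E}
    (hF : Measurable F) {t : ℕ} (hFt : ∀ ω ω' : ℕ → X, (∀ i < t, ω i = ω' i) → F ω = F ω') :
    (Measure.infinitePi fun _ : ℕ => ν).map (fun ω => (F ω, ω t))
      = ((Measure.infinitePi fun _ : ℕ => ν).map F).prod ν := by
  set P := Measure.infinitePi fun _ : ℕ => ν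
  have hind : iIndepFun (fun (i : ℕ) (ω : ℕ → X) => ω i) P :=
    iIndepFun_infinitePi (X := fun _ => id) (fun _ => measurable_id)
  have h := hind.indepFun_finset (Finset.range t) {t} (by simp) (fun i => measurable_pi_apply i)
  -- Padding the first `t` coordinates with a default value factors `F` through them; the padding is
  -- irrelevant because `F` ignores later coordinates.
  set ext : (Finset.range t → X) → (ℕ → X) := fun y i =>
    if hi : i ∈ Finset.range t then y ⟨i, hi⟩ else default with hext
  have hextm : Measurable ext := by
    refine measurable_pi_iff.2 fun i => ?_
    simp only [hext]
    split_ifs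
    · fun_prop
    · fun_prop
  have hlast : Measurable fun y : ({t} : Finset ℕ) → X => y ⟨t, Finset.mem_singleton_self t⟩ :=
    measurable_pi_apply _
  have h' := h.comp (hF.comp hextm) hlast
  have hFe : (F ∘ ext) ∘ (fun (ω : ℕ → X) (i : Finset.range t) => ω i) = F := by
    funext ω
    refine hFt _ _ fun i hi => ?_
    simp [hext, hi]
  rw [hFe] at h'
  have h2 := (indepFun_iff_map_prod_eq_prod_map_map hF.aemeasurable
    (measurable_pi_apply t).aemeasurable).1 h'
  rw [show P.map (fun ω => ω t) = ν from (measurePreserving_eval_infinitePi (fun _ => ν) t).map_eq]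
    at h2
  exact h2

/-- Integration over the coordinate `t` first, given a function of the earlier coordinates. -/
theorem integral_infinitePi_eq [Inhabited X] {E : Type*} [MeasurableSpace E] {F : (ℕ → X) → E}
    (hF : Measurable F) {t : ℕ} (hFt : ∀ ω ω' : ℕ → X, (∀ i < t, ω i = ω' i) → F ω = F ω')
    {h : E × X → ℝ} (hh : Measurable h)
    (hint : Integrable (fun ω => h (F ω, ω t)) (Measure.infinitePi fun _ : ℕ => ν)) :
    ∫ ω, h (F ω, ω t) ∂(Measure.infinitePi fun _ : ℕ => ν)
      = ∫ ω, ∫ x, h (F ω, x) ∂ν ∂(Measure.infinitePi fun _ : ℕ => ν) := by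
  have hm : Measurable fun ω : ℕ → X => (F ω, ω t) := hF.prodMk (measurable_pi_apply t)
  have hmap := map_prodMk_infinitePi ν hF hFt
  have : IsProbabilityMeasure ((Measure.infinitePi fun _ : ℕ => ν).map F) :=
    Measure.isProbabilityMeasure_map hF.aemeasurable
  rw [← integral_map (f := h) hm.aemeasurable hh.aestronglyMeasurable, hmap, integral_prod,
    integral_map hF.aemeasurable]
  · exact (hh.stronglyMeasurable.integral_prod_right').aestronglyMeasurable
  · rw [← hmap]
    exact (integrable_map_measure hh.aestronglyMeasurable hm.aemeasurable).2 hint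

/-- The preimage of a box under the shift is the box with shifted indices, which has the same
product measure. Stationarity is what makes the expected optimum subadditive. -/
theorem measurePreserving_shift (S : ℕ) :
    MeasurePreserving (fun (ω : ℕ → X) t => ω (S + t)) (Measure.infinitePi fun _ : ℕ => ν)
      (Measure.infinitePi fun _ : ℕ => ν) := by
  have hm : Measurable fun (ω : ℕ → X) t => ω (S + t) := by fun_prop
  refine ⟨hm, Measure.eq_infinitePi _ fun s u hu => ?_⟩
  rw [Measure.map_apply hm (MeasurableSet.pi s.countable_toSet fun i _ => hu i)]
  have : (fun (ω : ℕ → X) t => ω (S + t)) ⁻¹' (Set.pi s u)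
      = Set.pi (s.map (addLeftEmbedding S)) (fun i => u (i - S)) := by
    ext ω; simp [Set.mem_pi]
  rw [this, Measure.infinitePi_pi _ (fun i _ => hu _), Finset.prod_map]
  simp

end

/-! ### Laws of sample paths and conditioning on the past. -/

section

variable {A : Auction} {V : Measure ℝ} {D : Measure (ℝ × ℝ)} [IsProbabilityMeasure V]
  [IsProbabilityMeasure D] {B : ℝ}

instance : IsProbabilityMeasure (pathLaw V D) := by unfold pathLaw; infer_instance

omit [IsProbabilityMeasure V] [IsProbabilityMeasure D] in
theorem IsModel.ae_goodSample {νbar : ℝ} (h : IsModel A V D νbar) (hB : ∀ᵐ d ∂D, d.1 ≤ B) :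
    ∀ᵐ x ∂(V.prod D), GoodSample B x := by
  have hV : ∀ᵐ v ∂V, v ∈ Set.Icc (0 : ℝ) 1 := by
    obtain ⟨f, -, -, hf⟩ := h.density
    rw [hf]
    exact (withDensity_absolutelyContinuous _ _).ae_le (ae_restrict_mem measurableSet_Icc)
  have h1 : ∀ᵐ x ∂(V.prod D), x.1 ∈ Set.Icc (0 : ℝ) 1 := Measure.quasiMeasurePreserving_fst.ae hV
  have h2 : ∀ᵐ x ∂(V.prod D), 0 ≤ x.2.2 ∧ x.2.2 ≤ x.2.1 :=
    Measure.quasiMeasurePreserving_snd.ae h.bids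
  have h3 : ∀ᵐ x ∂(V.prod D), x.2.1 ≤ B := Measure.quasiMeasurePreserving_snd.ae hB
  filter_upwards [h1, h2, h3] with x a b c using ⟨a.1, a.2, b.1, b.2, c⟩

theorem ae_pathLaw_forall {p : Sample → Prop} (h : ∀ᵐ x ∂(V.prod D), p x) :
    ∀ᵐ ω ∂(pathLaw V D), ∀ t, p (ω t) :=
  ae_all_iff.2 fun t =>
    (measurePreserving_eval_infinitePi (fun _ : ℕ => V.prod D) t).quasiMeasurePreserving.ae h

theorem integral_eval (f : Sample → ℝ) (hf : AEStronglyMeasurable f (V.prod D)) (t : ℕ) :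
    ∫ ω, f (ω t) ∂(pathLaw V D) = ∫ x, f x ∂(V.prod D) := by
  have h := measurePreserving_eval_infinitePi (fun _ : ℕ => V.prod D) t
  rw [← h.map_eq] at hf
  rw [← h.map_eq, integral_map h.measurable.aemeasurable hf]
  rfl

theorem integrable_eval {f : Sample → ℝ} (hf : Integrable f (V.prod D)) (t : ℕ) :
    Integrable (fun ω => f (ω t)) (pathLaw V D) :=
  (measurePreserving_eval_infinitePi (fun _ : ℕ => V.prod D) t).integrable_comp_of_integrable hf

theorem integrable_of_abs_le {Ω : Type*} [MeasurableSpace Ω] {P : Measure Ω} [IsFiniteMeasure P]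
    {f : Ω → ℝ} (hf : AEStronglyMeasurable f P) {C : ℝ} (h : ∀ᵐ x ∂P, |f x| ≤ C) :
    Integrable f P :=
  Integrable.of_bound hf C h

/-- `F` is a measurable function of the first `t` coordinates of the path. -/
def IsPast {E : Type*} [MeasurableSpace E] (t : ℕ) (F : (ℕ → Sample) → E) : Prop :=
  Measurable F ∧ ∀ ω ω' : ℕ → Sample, (∀ i < t, ω i = ω' i) → F ω = F ω'

/-- Conditioning on the past: the weight `w` and the multiplier `q` are determined by the first
`t` periods, and `f` depends on `q` and on the sample of the following period. -/
theorem integral_past_mul {t : ℕ} {w q : (ℕ → Sample) → ℝ} (hw : IsPast t w) (hq : IsPast t q)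
    {W c : ℝ} (hW : ∀ᵐ ω ∂(pathLaw V D), |w ω| ≤ W) {f : ℝ → Sample → ℝ}
    (hf : Measurable fun p : ℝ × Sample => f p.1 p.2)
    (hc : ∀ᵐ x ∂(V.prod D), ∀ q, |f q x| ≤ c) {m : ℝ → ℝ}
    (hm : ∀ ω, ∫ x, f (q ω) x ∂(V.prod D) = m (q ω)) :
    Integrable (fun ω => w ω * f (q ω) (ω t)) (pathLaw V D) ∧
      Integrable (fun ω => w ω * m (q ω)) (pathLaw V D) ∧
      ∫ ω, w ω * f (q ω) (ω t) ∂(pathLaw V D) = ∫ ω, w ω * m (q ω) ∂(pathLaw V D) := by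
  have hF : Measurable fun ω => (w ω, q ω) := hw.1.prodMk hq.1
  have hW0 : 0 ≤ W := by
    obtain ⟨ω, hω⟩ := hW.exists
    exact (abs_nonneg _).trans hω
  have hh : Measurable fun p : (ℝ × ℝ) × Sample => p.1.1 * f p.1.2 p.2 :=
    (measurable_fst.comp measurable_fst).mul
      (hf.comp ((measurable_snd.comp measurable_fst).prodMk measurable_snd))
  have hint : Integrable (fun ω => w ω * f (q ω) (ω t)) (pathLaw V D) := by
    refine integrable_of_abs_le (C := W * c) ?_ ?_
    · exact (hh.comp (hF.prodMk (measurable_pi_apply t))).aestronglyMeasurable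
    · filter_upwards [hW, ae_pathLaw_forall hc] with ω h1 h2
      rw [abs_mul]
      exact mul_le_mul h1 (h2 t _) (abs_nonneg _) hW0
  have hmω : ∀ ω, ∫ x, w ω * f (q ω) x ∂(V.prod D) = w ω * m (q ω) := fun ω => by
    rw [integral_const_mul, hm]
  have hmq : Measurable fun ω => m (q ω) := by
    have := (hf.stronglyMeasurable.integral_prod_right' (ν := V.prod D)).measurable.comp hq.1
    simpa only [Function.comp_def, hm] using this
  refine ⟨hint, ?_, ?_⟩
  · refine integrable_of_abs_le (C := W * c) (hw.1.mul hmq).aestronglyMeasurable ?_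
    filter_upwards [hW] with ω h1
    rw [abs_mul, ← hm]
    refine mul_le_mul h1 ?_ (abs_nonneg _) hW0
    have := norm_integral_le_of_norm_le_const (μ := V.prod D) (f := f (q ω)) (C := c)
      (by filter_upwards [hc] with x hx using hx _)
    simpa using this
  · have := integral_infinitePi_eq (V.prod D) hF (t := t)
      (fun ω ω' h => by rw [hw.2 ω ω' h, hq.2 ω ω' h]) hh hint
    refine this.trans (integral_congr_ae (ae_of_all _ fun ω => ?_))
    exact hmω ω

/-! ### Expectations of one period and of the optimum in hindsight. -/

section

variable (hA : A.IsProper) (hg : ∀ᵐ x ∂(V.prod D), GoodSample B x)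
include hA hg

theorem integrable_gain (q : ℝ) :
    Integrable (fun x : Sample => gain A (A.Δ * x.1 / q) x.2) (V.prod D) := by
  refine integrable_of_abs_le (C := B) ?_ ?_
  · exact (Measurable.comp (measurable_gain A) (f := fun x : Sample => (A.Δ * x.1 / q, x.2))
      (by fun_prop)).aestronglyMeasurable
  · filter_upwards [hg] with x hx
    rw [abs_of_nonneg (gain_nonneg hA hx.snd_nonneg hx.snd_le)]
    exact (gain_le_fst hA hx.snd_nonneg hx.snd_le).trans hx.fst_le

omit hA in
theorem integrable_payment (q : ℝ) :
    Integrable (fun x : Sample => payment (A.Δ * x.1 / q) x.2) (V.prod D) := by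
  refine integrable_of_abs_le (C := B) ?_ ?_
  · exact (Measurable.comp measurable_payment (f := fun x : Sample => (A.Δ * x.1 / q, x.2))
      (by fun_prop)).aestronglyMeasurable
  · filter_upwards [hg] with x hx
    rw [abs_of_nonneg (payment_nonneg hx.fst_nonneg)]
    exact (payment_le hx.fst_nonneg).trans hx.fst_le

omit hA in
theorem integrable_val : Integrable (fun x : Sample => x.1) (V.prod D) := by
  refine integrable_of_abs_le (C := 1) measurable_fst.aestronglyMeasurable ?_
  filter_upwards [hg] with x hx
  rw [abs_of_nonneg hx.val_nonneg]
  exact hx.val_le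

omit hA in
theorem integrable_fst : Integrable (fun x : Sample => x.2.1) (V.prod D) := by
  refine integrable_of_abs_le (C := B) (by fun_prop) ?_
  filter_upwards [hg] with x hx
  rw [abs_of_nonneg hx.fst_nonneg]
  exact hx.fst_le

omit hA in
theorem integrable_snd : Integrable (fun x : Sample => x.2.2) (V.prod D) := by
  refine integrable_of_abs_le (C := B) (by fun_prop) ?_
  filter_upwards [hg] with x hx
  rw [abs_of_nonneg hx.snd_nonneg]
  exact hx.snd_le.trans hx.fst_le

omit hA in
theorem integrable_surplus (q : ℝ) :
    Integrable (fun x : Sample => max (A.Δ * x.1 - q * x.2.1) 0) (V.prod D) :=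
  (((integrable_val hg).const_mul _).sub ((integrable_fst hg).const_mul _)).pos_part

theorem integral_lossAt {q : ℝ} (hq : 0 < q) :
    ∫ x, lossAt A q x ∂(V.prod D) = karmaLoss A V D q := by
  unfold lossAt karmaLoss
  rw [integral_sub (integrable_payment hg q) (integrable_gain hA hg q)]
  congr 1
  refine integral_congr_ae (ae_of_all _ fun x => ?_)
  simp only [payment, lt_div_iff₀ hq, mul_comm x.2.1 q]

/-- The identity holds sample by sample: the gains cancel, and on a win the surplus Δv - qd^γ plus
the priced payment qd^γ is the saving Δv. -/
theorem integral_costAt {q : ℝ} (hq : 0 < q) :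
    ∫ x, costAt A q x ∂(V.prod D) = expectedCost A V D q := by
  have h1 := integrable_gain hA hg q
  have h2 := integrable_payment (A := A) hg q
  rw [expectedCost, ← integral_lossAt hA hg hq, dualObjective, ← integral_const_mul, ← integral_sub]
  · refine integral_congr_ae (ae_of_all _ fun x => ?_)
    simp only [costAt, cost, lossAt, payment, lt_div_iff₀ hq, mul_comm x.2.1 q]
    split_ifs with h
    · rw [max_eq_left (by linarith)]; ring
    · rw [max_eq_right (by linarith)]; ring
  · exact ((integrable_val hg).sub (h1.const_mul _)).sub (integrable_surplus hg q)
  · exact (h2.sub h1).const_mul _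

/-- Expectation of the Lagrangian lower bound on the cost of one period. -/
theorem le_integral_lagrangian {q : ℝ} (hq : 0 < q) :
    dualObjective A V D q - q * residualGain A D
      ≤ ∫ x : Sample, (x.1 - q * ((A.γ : ℝ) / A.N * x.2.1)
          - max (A.Δ * x.1 - q * x.2.1) 0) ∂(V.prod D) := by
  have h1 := integrable_gain hA hg q
  have hres : residualGain A D = ∫ x : Sample, (A.γ : ℝ) / A.N * (x.2.1 - x.2.2) ∂(V.prod D) := by
    rw [residualGain, integral_const_mul, integral_fun_snd (fun d : ℝ × ℝ => d.1 - d.2)]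
    simp
  have hi := ((integrable_fst hg).sub (integrable_snd hg)).const_mul ((A.γ : ℝ) / A.N)
  rw [hres, dualObjective, ← integral_const_mul, ← integral_sub]
  · refine integral_mono_ae ?_ ?_ ?_
    · exact (((integrable_val hg).sub (h1.const_mul _)).sub (integrable_surplus hg q)).sub
        (hi.const_mul _)
    · exact ((integrable_val hg).sub (((integrable_fst hg).const_mul _).const_mul _)).sub
        (integrable_surplus hg q)
    · filter_upwards [hg] with x hx
      -- The gain at any bid is at least (γ/N)d^{γ+1}, so the maximal gain (γ/N)d^γ exceeds it by at
      -- most the integrand of the residual gain.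
      have := mul_le_mul_of_nonneg_left (le_gain hA (b := A.Δ * x.1 / q) hx.snd_le) hq.le
      linarith
  · exact ((integrable_val hg).sub (h1.const_mul _)).sub (integrable_surplus hg q)
  · exact hi.const_mul _

theorem aemeasurable_hindsightCost {k : ℝ} (hk : 0 ≤ k) (T : ℕ) :
    AEMeasurable (hindsightCost A k T) (pathLaw V D) := by
  refine ⟨fun ω => (Finset.range T).powerset.inf' ⟨∅, by simp⟩
      (fun S => selectionCost A k T S ω), ?_, ?_⟩
  · have h : ∀ (s : Finset (Finset ℕ)) (hs : s.Nonempty),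
        Measurable fun ω => s.inf' hs (fun S => selectionCost A k T S ω) := by
      intro s hs
      have := Finset.inf'_induction (p := Measurable) hs
        (fun S : Finset ℕ => selectionCost A k T S) (fun f hf g hg => hf.inf hg)
        (fun S _ => measurable_selectionCost A k T S)
      convert this using 1
      funext ω
      rw [Finset.inf'_apply]
    exact h _ _
  · filter_upwards [ae_pathLaw_forall hg] with ω hω using hindsightCost_eq_inf' hA hω hk T

theorem integrable_hindsightCost {k : ℝ} (hk : 0 ≤ k) (T : ℕ) :
    Integrable (hindsightCost A k T) (pathLaw V D) := by
  refine integrable_of_abs_le (C := T) (aemeasurable_hindsightCost hA hg hk T).aestronglyMeasurable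
    ?_
  filter_upwards [ae_pathLaw_forall hg] with ω hω
  rw [abs_of_nonneg (hindsightCost_nonneg hA hω k T)]
  exact hindsightCost_le_horizon hA hω hk T

/-- Lower bound on the expected optimal cost in hindsight. -/
theorem le_integral_hindsightCost {k q : ℝ} (hk : 0 ≤ k) (hq : 0 < q) (T : ℕ) :
    T * (dualObjective A V D q - q * residualGain A D) - q * k
      ≤ ∫ ω, hindsightCost A k T ω ∂(pathLaw V D) := by
  have hi : Integrable (fun x : Sample => x.1 - q * ((A.γ : ℝ) / A.N * x.2.1)
      - max (A.Δ * x.1 - q * x.2.1) 0) (V.prod D) :=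
    ((integrable_val hg).sub (((integrable_fst hg).const_mul _).const_mul _)).sub
      (integrable_surplus hg q)
  have hmono : ∫ ω, (∑ t ∈ Finset.range T, ((ω t).1 - q * ((A.γ : ℝ) / A.N * (ω t).2.1)
      - max (A.Δ * (ω t).1 - q * (ω t).2.1) 0) - q * k) ∂(pathLaw V D)
      ≤ ∫ ω, hindsightCost A k T ω ∂(pathLaw V D) := by
    refine integral_mono_ae ?_ (integrable_hindsightCost hA hg hk T) ?_
    · exact (integrable_finsetSum _ fun t _ => integrable_eval hi t).sub (integrable_const _)
    · filter_upwards [ae_pathLaw_forall hg] with ω hω using sub_le_hindsightCost hA hω hk hq.le T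
  refine le_trans ?_ hmono
  rw [integral_sub (integrable_finsetSum _ fun t _ => integrable_eval hi t) (integrable_const _),
    integral_finsetSum _ fun t _ => integrable_eval hi t]
  rw [Finset.sum_congr rfl fun t _ => integral_eval _ hi.aestronglyMeasurable t]
  have := mul_le_mul_of_nonneg_left (le_integral_lagrangian hA hg hq) (Nat.cast_nonneg (α := ℝ) T)
  simpa using this

/-- The average expected optimal cost converges if the initial budget is negligible. -/
theorem exists_tendsto_hindsightCost {dlo : ℝ} (hdlo : 0 < dlo)
    (hd : ∀ᵐ x ∂(V.prod D), dlo ≤ x.2.1) {k : ℕ → ℝ} (hk : ∀ᶠ T in atTop, 0 ≤ k T)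
    (hkT : Tendsto (fun T : ℕ => k T / T) atTop (𝓝 0)) :
    ∃ h : ℝ, Tendsto (fun T : ℕ => (∫ ω, hindsightCost A (k T) T ω ∂(pathLaw V D)) / T) atTop
      (𝓝 h) := by
  set u : ℕ → ℝ := fun T => ∫ ω, hindsightCost A 0 T ω ∂(pathLaw V D) with hu
  have hi := fun T => integrable_hindsightCost hA hg (le_refl (0 : ℝ)) T
  -- Concatenation on each path and shift invariance of the law give subadditivity, to which
  -- Fekete's lemma applies.
  have hsub : Subadditive u := by
    intro S T
    have hs := measurePreserving_shift (V.prod D) S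
    have hT' : ∫ ω, hindsightCost A 0 T (fun t => ω (S + t)) ∂(pathLaw V D) = u T := by
      have hm := (aemeasurable_hindsightCost hA hg (le_refl (0 : ℝ)) T).aestronglyMeasurable
      have := integral_map (μ := pathLaw V D) hs.measurable.aemeasurable
        (f := hindsightCost A 0 T) (by rw [pathLaw, hs.map_eq]; exact hm)
      rw [← this, pathLaw, hs.map_eq]
      rfl
    have hiT : Integrable (fun ω : ℕ → Sample => hindsightCost A 0 T fun t => ω (S + t))
      (pathLaw V D) := hs.integrable_comp_of_integrable (hi T)
    rw [← hT']
    refine le_of_le_of_eq ?_ (integral_add (hi S) hiT)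
    refine integral_mono_ae (hi _) ((hi S).add hiT) ?_
    filter_upwards [ae_pathLaw_forall hg] with ω hω using hindsightCost_add_le hA hω S T
  have hbdd : BddBelow (Set.range fun n : ℕ => u n / n) := by
    refine ⟨0, ?_⟩
    rintro _ ⟨n, rfl⟩
    refine div_nonneg (integral_nonneg_of_ae ?_) (Nat.cast_nonneg _)
    filter_upwards [ae_pathLaw_forall hg] with ω hω using hindsightCost_nonneg hA hω 0 n
  have hlim := hsub.tendsto_lim hbdd
  refine ⟨hsub.lim, ?_⟩
  -- The optimum with budget `k T` lies between the zero-budget optimum and the same minus the worth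
  -- (`k T` + `B`)/`dlo` of the budget.
  have hlow : Tendsto (fun T : ℕ => u T / T - (k T / T + B / T) / dlo) atTop (𝓝 hsub.lim) := by
    have := hlim.sub ((hkT.add (tendsto_const_div_atTop_nhds_zero_nat B)).div_const dlo)
    simpa using this
  refine tendsto_of_tendsto_of_tendsto_of_le_of_le' hlow hlim ?_ ?_
  · filter_upwards [hk] with T hkT
    have h : u T ≤ ∫ ω, (hindsightCost A (k T) T ω + (k T + B) / dlo) ∂(pathLaw V D) := by
      refine integral_mono_ae (hi T)
        ((integrable_hindsightCost hA hg hkT T).add (integrable_const _)) ?_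
      filter_upwards [ae_pathLaw_forall hg, ae_pathLaw_forall hd] with ω hω hω'
        using hindsightCost_zero_le hA hω hdlo hω' hkT T
    rw [integral_add (integrable_hindsightCost hA hg hkT T) (integrable_const _)] at h
    simp only [integral_const, probReal_univ, one_smul] at h
    have h' := div_le_div_of_nonneg_right h (Nat.cast_nonneg (α := ℝ) T)
    rw [add_div] at h'
    have : (k T / T + B / T) / dlo = (k T + B) / dlo / T := by rw [← add_div, div_right_comm]
    rw [this]
    linarith
  · filter_upwards [hk] with T hkT
    refine div_le_div_of_nonneg_right ?_ (Nat.cast_nonneg _)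
    refine integral_mono_ae (integrable_hindsightCost hA hg hkT T) (hi T) ?_
    filter_upwards [ae_pathLaw_forall hg] with ω hω
      using hindsightCost_antitone hA hω le_rfl hkT T

end

end

/-! ### Paths of adaptive karma pacing -/

/-- The bid of the strategy in a period. -/
noncomputable def pacingBid (A : Auction) (I : Input) (ω : ℕ → Sample) (t : ℕ) : ℝ :=
  bid A I (mult A I ω t) (budget A I ω t) (ω t).1

/-- The projected multiplier in a period. -/
noncomputable def projMult (A : Auction) (I : Input) (t : ℕ) (ω : ℕ → Sample) : ℝ :=
  proj I.lo I.hi (mult A I ω t)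

theorem mult_succ (A : Auction) (I : Input) (ω : ℕ → Sample) (t : ℕ) :
    mult A I ω (t + 1) = mult A I ω t + I.ε *
      (payment (pacingBid A I ω t) (ω t).2 - gain A (pacingBid A I ω t) (ω t).2) := rfl

theorem budget_succ (A : Auction) (I : Input) (ω : ℕ → Sample) (t : ℕ) :
    budget A I ω (t + 1) = budget A I ω t - payment (pacingBid A I ω t) (ω t).2
      + gain A (pacingBid A I ω t) (ω t).2 := rfl

theorem measurable_bid (A : Auction) (I : Input) :
    Measurable fun p : ℝ × ℝ × ℝ => bid A I p.1 p.2.1 p.2.2 := by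
  unfold bid
  have : Measurable fun p : ℝ × ℝ × ℝ => proj I.lo I.hi p.1 :=
    (measurable_proj I.lo I.hi).comp measurable_fst
  exact (Measurable.div (by fun_prop) this).min (by fun_prop)

theorem isPast_state (A : Auction) (I : Input) (t : ℕ) : IsPast t fun ω => state A I ω t := by
  induction t with
  | zero => exact ⟨measurable_const, fun _ _ _ => rfl⟩
  | succ t ih =>
    refine ⟨?_, fun ω ω' h => ?_⟩
    · have hb : Measurable fun ω : ℕ → Sample =>
          bid A I (state A I ω t).1 (state A I ω t).2 (ω t).1 :=
        (measurable_bid A I).comp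
          (ih.1.fst.prodMk (ih.1.snd.prodMk (measurable_pi_apply t).fst))
      have hbd := hb.prodMk (measurable_pi_apply (X := fun _ : ℕ => Sample) t).snd
      have hz := measurable_payment.comp hbd
      have hg := (measurable_gain A).comp hbd
      exact (ih.1.fst.add ((hz.sub hg).const_mul I.ε)).prodMk ((ih.1.snd.sub hz).add hg)
    · have h1 := ih.2 ω ω' fun i hi => h i (by omega)
      simp only [state, h1, h t (Nat.lt_succ_self t)]

theorem isPast_mult (A : Auction) (I : Input) (t : ℕ) : IsPast t fun ω => mult A I ω t :=
  ⟨(isPast_state A I t).1.fst, fun ω ω' h => by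
    simp only [mult, (isPast_state A I t).2 ω ω' h]⟩

theorem isPast_budget (A : Auction) (I : Input) (t : ℕ) : IsPast t fun ω => budget A I ω t :=
  ⟨(isPast_state A I t).1.snd, fun ω ω' h => by
    simp only [budget, (isPast_state A I t).2 ω ω' h]⟩

theorem IsPast.comp {E E' : Type*} [MeasurableSpace E] [MeasurableSpace E'] {t : ℕ}
    {F : (ℕ → Sample) → E} (hF : IsPast t F) {φ : E → E'} (hφ : Measurable φ) :
    IsPast t fun ω => φ (F ω) :=
  ⟨hφ.comp hF.1, fun ω ω' h => by simp only [hF.2 ω ω' h]⟩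

theorem IsPast.mul {t : ℕ} {F G : (ℕ → Sample) → ℝ} (hF : IsPast t F) (hG : IsPast t G) :
    IsPast t fun ω => F ω * G ω :=
  ⟨hF.1.mul hG.1, fun ω ω' h => by simp only [hF.2 ω ω' h, hG.2 ω ω' h]⟩

theorem isPast_projMult (A : Auction) (I : Input) (t : ℕ) : IsPast t (projMult A I t) :=
  (isPast_mult A I t).comp (measurable_proj _ _)

theorem measurable_pacingBid (A : Auction) (I : Input) (t : ℕ) :
    Measurable fun ω => pacingBid A I ω t :=
  (measurable_bid A I).comp ((isPast_mult A I t).1.prodMk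
    ((isPast_budget A I t).1.prodMk (measurable_pi_apply t).fst))

theorem measurable_pacingCost (A : Auction) (I : Input) (T : ℕ) : Measurable (pacingCost A I T) :=
  Finset.measurable_fun_sum _ fun t _ => (measurable_cost A).comp
    ((measurable_pi_apply t).fst.prodMk
      ((measurable_pacingBid A I t).prodMk (measurable_pi_apply t).snd))

/-- The budget and the multiplier determine each other. -/
theorem mult_add_budget (A : Auction) (I : Input) (ω : ℕ → Sample) (t : ℕ) :
    mult A I ω t + I.ε * budget A I ω t = I.μ₁ + I.ε * I.k₁ := by
  induction t with
  | zero => rfl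
  | succ t ih => rw [mult_succ, budget_succ]; linarith

/-- Indicator that the budget has been at least `Δ / lo` up to period `t`. -/
noncomputable def active (A : Auction) (I : Input) (t : ℕ) (ω : ℕ → Sample) : ℝ :=
  Set.indicator {ω | ∀ s ≤ t, A.Δ / I.lo ≤ budget A I ω s} 1 ω

theorem active_of_forall {A : Auction} {I : Input} {t : ℕ} {ω : ℕ → Sample}
    (h : ∀ s ≤ t, A.Δ / I.lo ≤ budget A I ω s) : active A I t ω = 1 :=
  Set.indicator_of_mem (s := {ω | ∀ s ≤ t, A.Δ / I.lo ≤ budget A I ω s}) h _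

theorem active_of_not {A : Auction} {I : Input} {t : ℕ} {ω : ℕ → Sample}
    (h : ¬∀ s ≤ t, A.Δ / I.lo ≤ budget A I ω s) : active A I t ω = 0 :=
  Set.indicator_of_notMem (s := {ω | ∀ s ≤ t, A.Δ / I.lo ≤ budget A I ω s}) h _

theorem active_mem (A : Auction) (I : Input) (t : ℕ) (ω : ℕ → Sample) :
    0 ≤ active A I t ω ∧ active A I t ω ≤ 1 := by
  by_cases h : ∀ s ≤ t, A.Δ / I.lo ≤ budget A I ω s
  · simp [active_of_forall h]
  · simp [active_of_not h]

theorem isPast_active (A : Auction) (I : Input) (t : ℕ) : IsPast t (active A I t) := by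
  refine ⟨?_, fun ω ω' h => ?_⟩
  · refine measurable_one.indicator ?_
    have : {ω | ∀ s ≤ t, A.Δ / I.lo ≤ budget A I ω s}
        = ⋂ s ∈ Finset.range (t + 1), {ω | A.Δ / I.lo ≤ budget A I ω s} := by
      ext ω; simp
    rw [this]
    exact Finset.measurableSet_biInter _ fun s _ =>
      measurableSet_le measurable_const (isPast_budget A I s).1
  · have hs : ∀ s ≤ t, budget A I ω s = budget A I ω' s := fun s hs =>
      (isPast_budget A I s).2 ω ω' fun i hi => h i (by omega)
    have hiff : (∀ s ≤ t, A.Δ / I.lo ≤ budget A I ω s) ↔ ∀ s ≤ t, A.Δ / I.lo ≤ budget A I ω' s :=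
      forall₂_congr fun s hst => by rw [hs s hst]
    by_cases h' : ∀ s ≤ t, A.Δ / I.lo ≤ budget A I ω s
    · rw [active_of_forall h', active_of_forall (hiff.1 h')]
    · rw [active_of_not h', active_of_not (mt hiff.2 h')]

/-- The multiplier, frozen when the budget drops below `Δ / lo`. -/
noncomputable def stoppedMult (A : Auction) (I : Input) (t : ℕ) (ω : ℕ → Sample) : ℝ :=
  I.μ₁ + ∑ s ∈ Finset.range t, active A I s ω * (mult A I ω (s + 1) - mult A I ω s)

theorem stoppedMult_succ (A : Auction) (I : Input) (t : ℕ) (ω : ℕ → Sample) :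
    stoppedMult A I (t + 1) ω = stoppedMult A I t ω
      + active A I t ω * (mult A I ω (t + 1) - mult A I ω t) := by
  rw [stoppedMult, Finset.sum_range_succ, ← add_assoc, stoppedMult]

/-- If period `t` is active, so are all earlier ones, and the sum of increments telescopes to the
true multiplier. -/
theorem active_mul_stoppedMult (A : Auction) (I : Input) (t : ℕ) (ω : ℕ → Sample) :
    active A I t ω * stoppedMult A I t ω = active A I t ω * mult A I ω t := by
  by_cases h : ∀ s ≤ t, A.Δ / I.lo ≤ budget A I ω s
  · congr 1
    rw [stoppedMult, Finset.sum_congr rfl fun s hs => by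
      rw [active_of_forall fun r hr => h r (by rw [Finset.mem_range] at hs; omega), one_mul],
      Finset.sum_range_sub]
    exact add_sub_cancel _ _
  · simp [active_of_not h]

theorem measurable_stoppedMult (A : Auction) (I : Input) (t : ℕ) :
    Measurable (stoppedMult A I t) :=
  measurable_const.add (Finset.measurable_fun_sum _ fun s _ => (isPast_active A I s).1.mul
    ((isPast_mult A I (s + 1)).1.sub (isPast_mult A I s).1))

theorem projMult_mem {A : Auction} {I : Input} (h : I.lo ≤ I.hi) (t : ℕ) (ω : ℕ → Sample) :
    projMult A I t ω ∈ Set.Icc I.lo I.hi := proj_mem h _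

/-! ### Pathwise properties of the strategy. -/

section

variable {A : Auction} {I : Input} {B : ℝ} {ω : ℕ → Sample}

/-- The threshold Δ/`lo` is the largest bid that the projected multiplier can produce, so above it
the budget cap is slack. -/
theorem pacingBid_eq (hA : A.IsProper) (hlo : 0 < I.lo) (hlohi : I.lo ≤ I.hi) {t : ℕ}
    (hω : GoodSample B (ω t)) (h : A.Δ / I.lo ≤ budget A I ω t) :
    pacingBid A I ω t = A.Δ * (ω t).1 / projMult A I t ω := by
  refine min_eq_left (le_trans ?_ h)
  exact div_le_div₀ hA.Δ_pos.le (mul_le_of_le_one_right hA.Δ_pos.le hω.val_le) hlo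
    (proj_mem hlohi _).1

theorem active_mul_mult_sub (hA : A.IsProper) (hlo : 0 < I.lo) (hlohi : I.lo ≤ I.hi) {t : ℕ}
    (hω : GoodSample B (ω t)) : active A I t ω * (mult A I ω (t + 1) - mult A I ω t)
      = I.ε * (active A I t ω * lossAt A (projMult A I t ω) (ω t)) := by
  by_cases h : ∀ s ≤ t, A.Δ / I.lo ≤ budget A I ω s
  · rw [mult_succ, pacingBid_eq hA hlo hlohi hω (h t le_rfl), lossAt]
    ring
  · simp [active_of_not h]

theorem budget_nonneg (hA : A.IsProper) (hω : ∀ t, GoodSample B (ω t)) (hk : 0 ≤ I.k₁) (t : ℕ) :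
    0 ≤ budget A I ω t := by
  induction t with
  | zero => exact hk
  | succ t ih =>
    have hg := gain_nonneg hA (b := pacingBid A I ω t) (hω t).snd_nonneg (hω t).snd_le
    have hz : payment (pacingBid A I ω t) (ω t).2 ≤ budget A I ω t := by
      unfold payment
      split_ifs with h
      · exact h.le.trans (min_le_right _ _)
      · exact ih
    rw [budget_succ]
    linarith

theorem feasible_pacingBid (hA : A.IsProper) (hlo : 0 < I.lo) (hlohi : I.lo ≤ I.hi)
    (hω : ∀ t, GoodSample B (ω t)) (hk : 0 ≤ I.k₁) (T : ℕ) :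
    Feasible A I.k₁ T ω (pacingBid A I ω) := by
  refine ⟨fun t _ => le_min ?_ (budget_nonneg hA hω hk t), fun s _ => ?_⟩
  · exact div_nonneg (mul_nonneg hA.Δ_pos.le (hω t).val_nonneg)
      (hlo.le.trans (proj_mem hlohi _).1)
  · have hsum : ∀ n, budget A I ω n = I.k₁
        - ∑ t ∈ Finset.range n, payment (pacingBid A I ω t) (ω t).2
        + ∑ t ∈ Finset.range n, gain A (pacingBid A I ω t) (ω t).2 := by
      intro n
      induction n with
      | zero => simp [budget, state]
      | succ n ih => rw [budget_succ, ih, Finset.sum_range_succ, Finset.sum_range_succ]; ring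
    have h0 := budget_nonneg hA hω hk (s + 1)
    rw [budget_succ, hsum s] at h0
    rw [Finset.sum_range_succ]
    -- Feasibility excludes the gain of the current period, so nonnegativity of the next budget is
    -- not enough; a winning payment is instead bounded by the current budget through the cap on the
    -- bid.
    by_cases hwin : (ω s).2.1 < pacingBid A I ω s
    · have : payment (pacingBid A I ω s) (ω s).2 ≤ budget A I ω s := by
        rw [payment, if_pos hwin]
        exact hwin.le.trans (min_le_right _ _)
      rw [hsum s] at this
      linarith
    · have h1 := budget_nonneg hA hω hk s
      rw [hsum s] at h1
      rw [payment, if_neg hwin]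
      linarith

theorem hindsightCost_le_pacingCost (hA : A.IsProper) (hlo : 0 < I.lo) (hlohi : I.lo ≤ I.hi)
    (hω : ∀ t, GoodSample B (ω t)) (hk : 0 ≤ I.k₁) (T : ℕ) :
    hindsightCost A I.k₁ T ω ≤ pacingCost A I T ω :=
  hindsightCost_le hA (fun t => (hω t).val_nonneg) (feasible_pacingBid hA hlo hlohi hω hk T)

theorem pacingCost_mem (hA : A.IsProper) (hω : ∀ t, GoodSample B (ω t)) (T : ℕ) :
    0 ≤ pacingCost A I T ω ∧ pacingCost A I T ω ≤ T := by
  refine ⟨Finset.sum_nonneg fun t _ => cost_nonneg hA (hω t).val_nonneg, ?_⟩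
  calc pacingCost A I T ω ≤ ∑ t ∈ Finset.range T, (1 : ℝ) := Finset.sum_le_sum fun t _ =>
        (cost_le hA (hω t).val_nonneg).trans (hω t).val_le
    _ = T := by simp

theorem abs_mult_succ_sub_le (hA : A.IsProper) (hε : 0 < I.ε) {t : ℕ} (hω : GoodSample B (ω t)) :
    |mult A I ω (t + 1) - mult A I ω t| ≤ I.ε * B := by
  rw [mult_succ, add_sub_cancel_left, abs_mul, abs_of_pos hε]
  refine mul_le_mul_of_nonneg_left (abs_le.2 ⟨?_, ?_⟩) hε.le
  · have := neg_le_payment_sub_gain hA (b := pacingBid A I ω t) hω.snd_nonneg hω.snd_le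
    linarith [hω.fst_le]
  · exact (payment_sub_gain_le hA hω.snd_nonneg hω.snd_le).trans hω.fst_le

/-- This crude bound, like the one for the stopped multiplier, serves only integrability. -/
theorem abs_mult_sub_le (hA : A.IsProper) (hε : 0 < I.ε) (hω : ∀ t, GoodSample B (ω t)) (t : ℕ) :
    |mult A I ω t - I.μ₁| ≤ t * (I.ε * B) := by
  induction t with
  | zero => simp [mult, state]
  | succ t ih =>
    have := abs_add_le (mult A I ω (t + 1) - mult A I ω t) (mult A I ω t - I.μ₁)
    rw [sub_add_sub_cancel] at this
    push_cast
    linarith [abs_mult_succ_sub_le (I := I) hA hε (hω t)]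

theorem abs_stoppedMult_sub_le (hA : A.IsProper) (hε : 0 < I.ε) (hω : ∀ t, GoodSample B (ω t))
    (t : ℕ) : |stoppedMult A I t ω - I.μ₁| ≤ t * (I.ε * B) := by
  rw [stoppedMult, add_sub_cancel_left]
  refine (Finset.abs_sum_le_sum_abs _ _).trans ?_
  calc _ ≤ ∑ s ∈ Finset.range t, I.ε * B := Finset.sum_le_sum fun s _ => by
        rw [abs_mul, abs_of_nonneg (active_mem A I s ω).1]
        exact (mul_le_of_le_one_left (abs_nonneg _) (active_mem A I s ω).2).trans
          (abs_mult_succ_sub_le hA hε (hω s))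
    _ = t * (I.ε * B) := by simp

end

/-- A force that is strongly monotone on `[lo, hi]` stays so when its argument is projected. -/
theorem sub_mul_proj_le {L : ℝ → ℝ} {lo hi lam μs : ℝ} (hlam : 0 < lam) (h1 : lo < μs)
    (h2 : μs < hi) (h : ∀ q ∈ Set.Icc lo hi, L q * (q - μs) ≤ -lam * (q - μs) ^ 2) (m : ℝ) :
    (m - μs) * L (proj lo hi m) ≤ -(lam * (proj lo hi m - μs) ^ 2) := by
  have hlohi := (h1.trans h2).le
  rcases lt_or_ge m lo with hm | hm
  · have hp : proj lo hi m = lo := by rw [proj, max_eq_right hm.le, min_eq_left hlohi]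
    have := h lo ⟨le_rfl, hlohi⟩
    rw [hp]
    -- Strong decrease at the endpoint makes the force there point inwards. Since `m` lies farther
    -- from `μs` than `lo`, replacing `lo` by `m` in the first factor only makes the product more
    -- negative.
    have hL : 0 ≤ L lo := by
      by_contra hneg
      push Not at hneg
      nlinarith [mul_pos_of_neg_of_neg hneg (sub_neg.2 h1), sq_nonneg (lo - μs)]
    nlinarith
  rcases lt_or_ge hi m with hm' | hm'
  · have hp : proj lo hi m = hi := by
      rw [proj, max_eq_left hm, min_eq_right hm'.le]
    have := h hi ⟨hlohi, le_rfl⟩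
    rw [hp]
    have hL : L hi ≤ 0 := by
      by_contra hpos
      push Not at hpos
      nlinarith [mul_pos hpos (sub_pos.2 h2), sq_nonneg (hi - μs)]
    nlinarith
  · rw [proj_of_mem ⟨hm, hm'⟩]
    linarith [h m ⟨hm, hm'⟩]

/-! ### The expected cost of adaptive karma pacing -/

section

variable {A : Auction} {I : Input} {V : Measure ℝ} {D : Measure (ℝ × ℝ)} [IsProbabilityMeasure V]
  [IsProbabilityMeasure D] {B : ℝ}

theorem integrable_pacingCost (hA : A.IsProper) (hg : ∀ᵐ x ∂(V.prod D), GoodSample B x) (T : ℕ) :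
    Integrable (pacingCost A I T) (pathLaw V D) := by
  refine integrable_of_abs_le (C := T) (measurable_pacingCost A I T).aestronglyMeasurable ?_
  filter_upwards [ae_pathLaw_forall hg] with ω hω
  rw [abs_of_nonneg (pacingCost_mem hA hω T).1]
  exact (pacingCost_mem hA hω T).2

theorem integrable_active (A : Auction) (I : Input) (t : ℕ) :
    Integrable (active A I t) (pathLaw V D) :=
  integrable_of_abs_le (C := 1) (isPast_active A I t).1.aestronglyMeasurable
    (ae_of_all _ fun ω => by
      rw [abs_of_nonneg (active_mem A I t ω).1]; exact (active_mem A I t ω).2)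

theorem integrable_active_mul_sq (h : I.lo ≤ I.hi) (t : ℕ) (μs : ℝ) :
    Integrable (fun ω => active A I t ω * (projMult A I t ω - μs) ^ 2) (pathLaw V D) := by
  have hm := (isPast_projMult A I t).1
  refine integrable_of_abs_le (C := (|I.lo| + |I.hi| + |μs|) ^ 2)
    ((isPast_active A I t).1.mul ((hm.sub_const μs).pow_const 2)).aestronglyMeasurable
    (ae_of_all _ fun ω => ?_)
  have hq := projMult_mem (A := A) h t ω
  rw [abs_of_nonneg (mul_nonneg (active_mem A I t ω).1 (sq_nonneg _))]
  refine (mul_le_of_le_one_left (sq_nonneg _) (active_mem A I t ω).2).trans ?_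
  refine sq_le_sq' ?_ ?_ <;>
  linarith [hq.1, hq.2, neg_abs_le I.lo, le_abs_self I.hi, neg_abs_le μs, le_abs_self μs,
    abs_nonneg I.lo, abs_nonneg I.hi]

variable (hA : A.IsProper) (hg : ∀ᵐ x ∂(V.prod D), GoodSample B x) (hε : 0 < I.ε)
include hA hg hε

theorem integrable_stoppedMult (t : ℕ) : Integrable (stoppedMult A I t) (pathLaw V D) := by
  refine integrable_of_abs_le (C := t * (I.ε * B) + |I.μ₁|)
    (measurable_stoppedMult A I t).aestronglyMeasurable ?_
  filter_upwards [ae_pathLaw_forall hg] with ω hω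
  have := abs_add_le (stoppedMult A I t ω - I.μ₁) I.μ₁
  rw [sub_add_cancel] at this
  linarith [abs_stoppedMult_sub_le (I := I) hA hε hω t]

theorem integrable_stoppedMult_sq (t : ℕ) (μs : ℝ) :
    Integrable (fun ω => (stoppedMult A I t ω - μs) ^ 2) (pathLaw V D) := by
  refine integrable_of_abs_le (C := (t * (I.ε * B) + |I.μ₁ - μs|) ^ 2)
    (((measurable_stoppedMult A I t).sub_const μs).pow_const 2).aestronglyMeasurable ?_
  filter_upwards [ae_pathLaw_forall hg] with ω hω
  rw [abs_of_nonneg (sq_nonneg _), ← sq_abs]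
  refine pow_le_pow_left₀ (abs_nonneg _) ?_ 2
  have := abs_add_le (stoppedMult A I t ω - I.μ₁) (I.μ₁ - μs)
  rw [sub_add_sub_cancel] at this
  linarith [abs_stoppedMult_sub_le (I := I) hA hε hω t]

variable (hlo : 0 < I.lo) (hlohi : I.lo ≤ I.hi)
include hlo hlohi

/-- The drift of the stopped multiplier is the expected karma loss at the projected multiplier. -/
theorem integral_stoppedMult_succ (t : ℕ) :
    Integrable (fun ω => active A I t ω * karmaLoss A V D (projMult A I t ω)) (pathLaw V D) ∧
    ∫ ω, stoppedMult A I (t + 1) ω ∂(pathLaw V D) = ∫ ω, stoppedMult A I t ω ∂(pathLaw V D)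
      + I.ε * ∫ ω, active A I t ω * karmaLoss A V D (projMult A I t ω) ∂(pathLaw V D) := by
  obtain ⟨h1, h2, h3⟩ := integral_past_mul (isPast_active A I t) (isPast_projMult A I t) (W := 1)
    (c := B) (V := V) (D := D)
    (ae_of_all _ fun ω => by
      rw [abs_of_nonneg (active_mem A I t ω).1]; exact (active_mem A I t ω).2)
    (measurable_lossAt A) (by filter_upwards [hg] with x hx q using abs_lossAt_le hA hx)
    (fun ω => integral_lossAt hA hg (hlo.trans_le (projMult_mem hlohi t ω).1))
  refine ⟨h2, ?_⟩
  rw [← h3, ← integral_const_mul,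
    ← integral_add (integrable_stoppedMult hA hg hε t) (h1.const_mul _)]
  refine integral_congr_ae ?_
  filter_upwards [ae_pathLaw_forall hg] with ω hω
  rw [stoppedMult_succ, active_mul_mult_sub hA hlo hlohi (hω t)]

/-- One step of the descent argument for the squared distance to the stationary multiplier. -/
theorem integral_sq_succ_le {μs lam : ℝ} (hlam : 0 < lam) (h1 : I.lo < μs) (h2 : μs < I.hi)
    (hdec : ∀ q ∈ Set.Icc I.lo I.hi, karmaLoss A V D q * (q - μs) ≤ -lam * (q - μs) ^ 2) (t : ℕ) :
    ∫ ω, (stoppedMult A I (t + 1) ω - μs) ^ 2 ∂(pathLaw V D)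
      + 2 * I.ε * lam * ∫ ω, active A I t ω * (projMult A I t ω - μs) ^ 2 ∂(pathLaw V D)
      ≤ ∫ ω, (stoppedMult A I t ω - μs) ^ 2 ∂(pathLaw V D) + I.ε ^ 2 * B ^ 2 := by
  have hw : IsPast t fun ω => active A I t ω * (mult A I ω t - μs) :=
    (isPast_active A I t).mul ((isPast_mult A I t).comp (measurable_id.sub_const μs))
  obtain ⟨i1, i2, i3⟩ := integral_past_mul hw (isPast_projMult A I t)
    (W := t * (I.ε * B) + |I.μ₁ - μs|) (c := B) (V := V) (D := D)
    (by
      filter_upwards [ae_pathLaw_forall hg] with ω hω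
      rw [abs_mul, abs_of_nonneg (active_mem A I t ω).1]
      refine (mul_le_of_le_one_left (abs_nonneg _) (active_mem A I t ω).2).trans ?_
      have := abs_add_le (mult A I ω t - I.μ₁) (I.μ₁ - μs)
      rw [sub_add_sub_cancel] at this
      linarith [abs_mult_sub_le (I := I) hA hε hω t])
    (measurable_lossAt A) (by filter_upwards [hg] with x hx q using abs_lossAt_le hA hx)
    (fun ω => integral_lossAt hA hg (hlo.trans_le (projMult_mem hlohi t ω).1))
  have hsq := integrable_stoppedMult_sq hA hg hε (I := I) t μs
  have hQ := integrable_active_mul_sq (A := A) (V := V) (D := D) hlohi t μs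
  -- The square is expanded. In the cross term the indicator allows the stopped multiplier to be
  -- replaced by the true one, which is the weight handled by conditioning on the past.
  have hstep : ∫ ω, (stoppedMult A I (t + 1) ω - μs) ^ 2 ∂(pathLaw V D)
      ≤ ∫ ω, ((stoppedMult A I t ω - μs) ^ 2 + 2 * I.ε *
          (active A I t ω * (mult A I ω t - μs) * lossAt A (projMult A I t ω) (ω t))
          + I.ε ^ 2 * B ^ 2) ∂(pathLaw V D) := by
    refine integral_mono_ae (integrable_stoppedMult_sq hA hg hε (t + 1) μs)
      ((hsq.add (i1.const_mul _)).add (integrable_const _)) ?_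
    filter_upwards [ae_pathLaw_forall hg] with ω hω
    have ha := active_mul_stoppedMult A I t ω
    have hl := abs_lossAt_le hA (q := projMult A I t ω) (hω t)
    rw [stoppedMult_succ, active_mul_mult_sub hA hlo hlohi (hω t)]
    set a := active A I t ω
    set l := lossAt A (projMult A I t ω) (ω t)
    set m := stoppedMult A I t ω
    have hal : (a * l) ^ 2 ≤ B ^ 2 := by
      rw [← sq_abs (a * l)]
      refine pow_le_pow_left₀ (abs_nonneg _) ?_ 2
      rw [abs_mul, abs_of_nonneg (active_mem A I t ω).1]
      exact (mul_le_of_le_one_left (abs_nonneg _) (active_mem A I t ω).2).trans hl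
    have e : (m + I.ε * (a * l) - μs) ^ 2 = (m - μs) ^ 2 + 2 * I.ε * ((a * m - a * μs) * l)
        + I.ε ^ 2 * (a * l) ^ 2 := by ring
    rw [e, ha, ← mul_sub]
    exact add_le_add le_rfl (mul_le_mul_of_nonneg_left hal (sq_nonneg _))
  have hdrift : ∫ ω, active A I t ω * (mult A I ω t - μs) * karmaLoss A V D (projMult A I t ω)
      ∂(pathLaw V D) ≤ ∫ ω, -lam * (active A I t ω * (projMult A I t ω - μs) ^ 2)
        ∂(pathLaw V D) := by
    refine integral_mono i2 (hQ.const_mul _) fun ω => ?_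
    have := mul_le_mul_of_nonneg_left (sub_mul_proj_le hlam h1 h2 hdec (mult A I ω t))
      (active_mem A I t ω).1
    dsimp only [projMult]
    linarith
  have hadd : Integrable (fun ω => (stoppedMult A I t ω - μs) ^ 2 + 2 * I.ε *
      (active A I t ω * (mult A I ω t - μs) * lossAt A (projMult A I t ω) (ω t)))
      (pathLaw V D) := hsq.add (i1.const_mul _)
  rw [integral_add hadd (integrable_const _), integral_add hsq (i1.const_mul _), integral_const_mul, i3] at hstep
  simp only [integral_const, probReal_univ, one_smul] at hstep
  rw [integral_const_mul] at hdrift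
  have := mul_le_mul_of_nonneg_left hdrift (by positivity : (0 : ℝ) ≤ 2 * I.ε)
  linarith

/-- The one-step inequalities telescope. Both terms on the left are needed: the second moment
controls the final drift, the sum controls the quadratic error of the cost. -/
theorem integral_sq_add_sum_le {μs lam : ℝ} (hlam : 0 < lam) (h1 : I.lo < μs) (h2 : μs < I.hi)
    (hdec : ∀ q ∈ Set.Icc I.lo I.hi, karmaLoss A V D q * (q - μs) ≤ -lam * (q - μs) ^ 2) (T : ℕ) :
    ∫ ω, (stoppedMult A I T ω - μs) ^ 2 ∂(pathLaw V D)
      + 2 * I.ε * lam * ∑ t ∈ Finset.range T,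
          ∫ ω, active A I t ω * (projMult A I t ω - μs) ^ 2 ∂(pathLaw V D)
      ≤ (I.μ₁ - μs) ^ 2 + T * (I.ε ^ 2 * B ^ 2) := by
  induction T with
  | zero => simp [stoppedMult]
  | succ T ih =>
    have := integral_sq_succ_le hA hg hε hlo hlohi hlam h1 h2 hdec T
    rw [Finset.sum_range_succ]
    push_cast
    linarith

theorem sum_integral_karmaLoss (T : ℕ) :
    I.ε * ∑ t ∈ Finset.range T,
      ∫ ω, active A I t ω * karmaLoss A V D (projMult A I t ω) ∂(pathLaw V D)
      = ∫ ω, stoppedMult A I T ω ∂(pathLaw V D) - I.μ₁ := by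
  induction T with
  | zero => simp [stoppedMult]
  | succ T ih =>
    rw [Finset.sum_range_succ, mul_add, ih, (integral_stoppedMult_succ hA hg hε hlo hlohi T).2]
    ring

omit hlo hlohi in
-- By |x| ≤ (1 + x²)/2, the second moment already bounded also controls the mean.
theorem abs_integral_stoppedMult_sub_le (μs : ℝ) (T : ℕ) :
    |∫ ω, stoppedMult A I T ω ∂(pathLaw V D) - I.μ₁|
      ≤ |I.μ₁ - μs| + (1 + ∫ ω, (stoppedMult A I T ω - μs) ^ 2 ∂(pathLaw V D)) / 2 := by
  have hm := integrable_stoppedMult hA hg hε (I := I) T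
  have hsq := integrable_stoppedMult_sq hA hg hε (I := I) T μs
  have h : |∫ ω, (stoppedMult A I T ω - μs) ∂(pathLaw V D)|
      ≤ ∫ ω, (1 + (stoppedMult A I T ω - μs) ^ 2) / 2 ∂(pathLaw V D) := by
    refine (abs_integral_le_integral_abs).trans ?_
    refine integral_mono (hm.sub (integrable_const _)).abs
      (((integrable_const _).add hsq).div_const _) fun ω => ?_
    have := sq_nonneg (|stoppedMult A I T ω - μs| - 1)
    rw [sub_sq, sq_abs] at this
    dsimp only
    linarith
  rw [integral_div, integral_add (integrable_const _) hsq, integral_sub hm (integrable_const _)] at h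
  simp only [integral_const, probReal_univ, one_smul] at h
  have := abs_sub_le (∫ ω, stoppedMult A I T ω ∂(pathLaw V D)) μs I.μ₁
  rw [abs_sub_comm μs] at this
  linarith

end

/-- The constant in front of `1 / ε + ε * T` in the bound on the expected cost. -/
noncomputable def pacingConst (B lo hi lam Z₁ Z₂ G₂ : ℝ) : ℝ :=
  hi * Z₁ / lam * ((hi - lo) + (1 + (hi - lo) ^ 2 + B ^ 2) / 2)
    + (Z₁ + hi * Z₂ + hi * Z₁ / lam * (Z₂ + G₂)) * (((hi - lo) ^ 2 + B ^ 2) / (2 * lam))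

theorem pacingConst_nonneg {B lo hi lam Z₁ Z₂ G₂ : ℝ} (hlo : 0 < lo) (hlohi : lo < hi)
    (hlam : 0 < lam) (hZ₁ : 0 < Z₁) (hZ₂ : 0 < Z₂) (hG₂ : 0 < G₂) :
    0 ≤ pacingConst B lo hi lam Z₁ Z₂ G₂ := by
  have h1 := sub_pos.2 hlohi
  have h2 := hlo.trans hlohi
  unfold pacingConst
  positivity

section

variable {A : Auction} {I : Input} {V : Measure ℝ} {D : Measure (ℝ × ℝ)} [IsProbabilityMeasure V]
  [IsProbabilityMeasure D] {B : ℝ}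

/-- Pathwise comparison of the cost of pacing with the cost at the projected multipliers. -/
theorem abs_pacingCost_sub_sum_le (hA : A.IsProper) (hlo : 0 < I.lo) (hlohi : I.lo ≤ I.hi)
    {ω : ℕ → Sample} (hω : ∀ t, GoodSample B (ω t)) {c : ℝ} (hc : c ∈ Set.Icc 0 1) (T : ℕ) :
    |pacingCost A I T ω - T * c
      - ∑ t ∈ Finset.range T, active A I t ω * (costAt A (projMult A I t ω) (ω t) - c)|
      ≤ ∑ t ∈ Finset.range T, (1 - active A I t ω) := by
  -- Active periods match exactly; an inactive one contributes a difference of two numbers in [0,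
  -- 1].
  have e : pacingCost A I T ω - T * c
      - ∑ t ∈ Finset.range T, active A I t ω * (costAt A (projMult A I t ω) (ω t) - c)
      = ∑ t ∈ Finset.range T, (1 - active A I t ω) *
        (cost A (ω t).1 (pacingBid A I ω t) (ω t).2 - c) := by
    have : (T : ℝ) * c = ∑ t ∈ Finset.range T, c := by simp
    rw [this, pacingCost, ← Finset.sum_sub_distrib, ← Finset.sum_sub_distrib]
    refine Finset.sum_congr rfl fun t _ => ?_
    change cost A (ω t).1 (pacingBid A I ω t) (ω t).2 - c - _ = _
    by_cases h : ∀ s ≤ t, A.Δ / I.lo ≤ budget A I ω s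
    · rw [active_of_forall h, pacingBid_eq hA hlo hlohi (hω t) (h t le_rfl), costAt]
      ring
    · rw [active_of_not h]
      ring
  rw [e]
  refine (Finset.abs_sum_le_sum_abs _ _).trans (Finset.sum_le_sum fun t _ => ?_)
  have ha := active_mem A I t ω
  rw [abs_mul, abs_of_nonneg (sub_nonneg.2 ha.2)]
  refine mul_le_of_le_one_right (sub_nonneg.2 ha.2) (abs_le.2 ⟨?_, ?_⟩)
  · linarith [cost_nonneg hA (b := pacingBid A I ω t) (d := (ω t).2) (hω t).val_nonneg, hc.2]
  · linarith [cost_le hA (b := pacingBid A I ω t) (d := (ω t).2) (hω t).val_nonneg,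
      (hω t).val_le, hc.1]

theorem expectedCost_mem (hA : A.IsProper) (hg : ∀ᵐ x ∂(V.prod D), GoodSample B x) {q : ℝ}
    (hq : 0 < q) : expectedCost A V D q ∈ Set.Icc 0 1 := by
  rw [← integral_costAt hA hg hq]
  refine ⟨integral_nonneg_of_ae (by filter_upwards [hg] with x hx using (costAt_mem hA hx).1), ?_⟩
  have : Integrable (costAt A q) (V.prod D) := by
    refine integrable_of_abs_le (C := 1)
      (Measurable.comp (measurable_costAt A) (f := fun x => (q, x))
        (by fun_prop)).aestronglyMeasurable ?_
    filter_upwards [hg] with x hx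
    rw [abs_of_nonneg (costAt_mem hA hx).1]
    exact (costAt_mem hA hx).2
  refine (integral_mono_ae this (integrable_const 1)
    (by filter_upwards [hg] with x hx using (costAt_mem hA hx).2)).trans (by simp)

/-- The expected cost of adaptive karma pacing is close to that of the stationary multiplier. -/
theorem abs_integral_pacingCost_sub_le (hA : A.IsProper)
    (hg : ∀ᵐ x ∂(V.prod D), GoodSample B x) (hlo : 0 < I.lo) (hε : 0 < I.ε)
    (hμ : I.μ₁ ∈ Set.Icc I.lo I.hi) {lam Z₁ Z₂ G₁ G₂ μs : ℝ} (hlam : 0 < lam)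
    (hZ₁ : 0 < Z₁) (hZ₂ : 0 < Z₂) (hG₂ : 0 < G₂)
    (h : HasRegularity A V D I.lo I.hi lam Z₁ Z₂ G₁ G₂ μs) (h1 : I.lo < μs) (h2 : μs < I.hi)
    (T : ℕ) :
    |∫ ω, pacingCost A I T ω ∂(pathLaw V D) - T * expectedCost A V D μs|
      ≤ pacingConst B I.lo I.hi lam Z₁ Z₂ G₂ * (1 / I.ε + I.ε * T)
        + ∫ ω, ∑ t ∈ Finset.range T, (1 - active A I t ω) ∂(pathLaw V D) := by
  have hlohi : I.lo ≤ I.hi := (h1.trans h2).le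
  have hhi : 0 < I.hi := hlo.trans_le hlohi
  obtain ⟨ρ, hρ, hK⟩ := h.exists_abs_expectedCost_sub_le hlo hlam h1 h2
  set c := expectedCost A V D μs with hc
  have hcm : c ∈ Set.Icc 0 1 := expectedCost_mem hA hg (hlo.trans h1)
  set Kq := Z₁ + I.hi * Z₂ + I.hi * Z₁ / lam * (Z₂ + G₂) with hKq
  have hKq0 : 0 ≤ Kq := by positivity
  set Q : ℕ → ℝ := fun t => ∫ ω, active A I t ω * (projMult A I t ω - μs) ^ 2 ∂(pathLaw V D)
  set R : ℕ → ℝ := fun t =>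
    ∫ ω, active A I t ω * karmaLoss A V D (projMult A I t ω) ∂(pathLaw V D)
  set U := ∫ ω, (stoppedMult A I T ω - μs) ^ 2 ∂(pathLaw V D) with hU
  have hU0 : 0 ≤ U := integral_nonneg fun ω => sq_nonneg _
  have hQ0 : 0 ≤ ∑ t ∈ Finset.range T, Q t := Finset.sum_nonneg fun t _ =>
    integral_nonneg fun ω => mul_nonneg (active_mem A I t ω).1 (sq_nonneg _)
  have hdist : |I.μ₁ - μs| ≤ I.hi - I.lo :=
    abs_sub_le_iff.2 ⟨by linarith [hμ.2], by linarith [hμ.1]⟩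
  have hdist2 : (I.μ₁ - μs) ^ 2 ≤ (I.hi - I.lo) ^ 2 := by
    rw [← sq_abs]; exact pow_le_pow_left₀ (abs_nonneg _) hdist 2
  have hdesc := integral_sq_add_sum_le hA hg hε hlo hlohi hlam h1 h2 h.strong_decrease T
  have hsumR := sum_integral_karmaLoss hA hg hε hlo hlohi (I := I) T
  have hm := abs_integral_stoppedMult_sub_le hA hg hε (I := I) μs T
  -- The descent bound has the form constant times 1 + ε²T, which is ε`s`; dividing by ε leaves `s`
  -- as the common rate of both sums.
  set s := 1 / I.ε + I.ε * T with hs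
  have hεs : I.ε * s = 1 + I.ε ^ 2 * T := by rw [hs]; field_simp
  have hεT : 0 ≤ I.ε ^ 2 * T := by positivity
  have hQs : ∑ t ∈ Finset.range T, Q t ≤ ((I.hi - I.lo) ^ 2 + B ^ 2) / (2 * lam) * s := by
    have : 0 < I.ε * (2 * lam) := by positivity
    refine le_of_mul_le_mul_left ?_ this
    have e : I.ε * (2 * lam) * (((I.hi - I.lo) ^ 2 + B ^ 2) / (2 * lam) * s)
        = ((I.hi - I.lo) ^ 2 + B ^ 2) * (I.ε * s) := by field_simp
    rw [e, hεs]
    nlinarith [mul_nonneg (sq_nonneg (I.hi - I.lo)) hεT, sq_nonneg B]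
  have hRs : |∑ t ∈ Finset.range T, R t|
      ≤ ((I.hi - I.lo) + (1 + (I.hi - I.lo) ^ 2 + B ^ 2) / 2) * s := by
    refine le_of_mul_le_mul_left ?_ hε
    have e : I.ε * |∑ t ∈ Finset.range T, R t|
        = |∫ ω, stoppedMult A I T ω ∂(pathLaw V D) - I.μ₁| := by
      rw [← hsumR, abs_mul, abs_of_pos hε]
    rw [e, mul_left_comm, hεs]
    have hUle : U ≤ (I.hi - I.lo) ^ 2 + T * (I.ε ^ 2 * B ^ 2) := by
      have : 0 ≤ 2 * I.ε * lam * ∑ t ∈ Finset.range T, Q t := by positivity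
      linarith
    nlinarith [mul_nonneg (sq_nonneg (I.hi - I.lo)) hεT, sq_nonneg B,
      mul_nonneg (sub_nonneg.2 hlohi) hεT]
  -- Conditioning on the past turns the cost of an active period into c(q) at the projected
  -- multiplier, where the second-order expansion applies.
  have hcost : ∀ t,
      Integrable (fun ω => active A I t ω * (costAt A (projMult A I t ω) (ω t) - c))
        (pathLaw V D) ∧
      |∫ ω, active A I t ω * (costAt A (projMult A I t ω) (ω t) - c) ∂(pathLaw V D) - ρ * R t|
        ≤ Kq * Q t := by
    intro t
    have hact : ∀ᵐ ω ∂(pathLaw V D), |active A I t ω| ≤ 1 := ae_of_all _ fun ω => by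
      rw [abs_of_nonneg (active_mem A I t ω).1]; exact (active_mem A I t ω).2
    obtain ⟨i1, i2, i3⟩ := integral_past_mul (isPast_active A I t) (isPast_projMult A I t)
      (W := 1) (c := 1) (V := V) (D := D) hact (f := fun q x => costAt A q x - c)
      ((measurable_costAt A).sub_const c) (m := fun q => expectedCost A V D q - c)
      (by
        filter_upwards [hg] with x hx q
        have := costAt_mem hA (q := q) hx
        exact abs_le.2 ⟨by linarith [this.1, hcm.2], by linarith [this.2, hcm.1]⟩)
      (fun ω => by
        have hq : 0 < projMult A I t ω := hlo.trans_le (projMult_mem hlohi t ω).1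
        have hi : Integrable (costAt A (projMult A I t ω)) (V.prod D) := by
          refine integrable_of_abs_le (C := 1) (Measurable.comp (measurable_costAt A)
            (f := fun x => (projMult A I t ω, x)) (by fun_prop)).aestronglyMeasurable ?_
          filter_upwards [hg] with x hx
          rw [abs_of_nonneg (costAt_mem hA hx).1]
          exact (costAt_mem hA hx).2
        rw [integral_sub hi (integrable_const _), integral_costAt hA hg hq]
        simp)
    refine ⟨i1, ?_⟩
    have hR := (integral_stoppedMult_succ hA hg hε hlo hlohi (I := I) t).1
    rw [i3, ← integral_const_mul, ← integral_sub i2 (hR.const_mul _), ← integral_const_mul]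
    refine abs_integral_le_integral_abs.trans (integral_mono (i2.sub (hR.const_mul _)).abs
      ((integrable_active_mul_sq hlohi t μs).const_mul _) fun ω => ?_)
    have := mul_le_mul_of_nonneg_left (hK _ (projMult_mem (A := A) hlohi t ω))
      (active_mem A I t ω).1
    have e : active A I t ω * (expectedCost A V D (projMult A I t ω) - c)
        - ρ * (active A I t ω * karmaLoss A V D (projMult A I t ω))
        = active A I t ω * (expectedCost A V D (projMult A I t ω) - c
          - ρ * karmaLoss A V D (projMult A I t ω)) := by ring
    dsimp only
    rw [e, abs_mul, abs_of_nonneg (active_mem A I t ω).1]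
    linarith
  have hpath : |∫ ω, pacingCost A I T ω ∂(pathLaw V D) - T * c - ∑ t ∈ Finset.range T,
        ∫ ω, active A I t ω * (costAt A (projMult A I t ω) (ω t) - c) ∂(pathLaw V D)|
      ≤ ∫ ω, ∑ t ∈ Finset.range T, (1 - active A I t ω) ∂(pathLaw V D) := by
    have hp := integrable_pacingCost hA hg (I := I) T
    have hpc : Integrable (fun ω => pacingCost A I T ω - T * c) (pathLaw V D) :=
      hp.sub (integrable_const _)
    have hsum := integrable_finsetSum (Finset.range T) fun t _ => (hcost t).1
    rw [← integral_finsetSum _ fun t _ => (hcost t).1]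
    have e : ∫ ω, pacingCost A I T ω ∂(pathLaw V D) - T * c
        = ∫ ω, (pacingCost A I T ω - T * c) ∂(pathLaw V D) := by
      rw [integral_sub hp (integrable_const _)]; simp
    rw [e, ← integral_sub hpc hsum]
    refine abs_integral_le_integral_abs.trans (integral_mono_ae (hpc.sub hsum).abs
      (integrable_finsetSum _ fun t _ => (integrable_const _).sub (integrable_active A I t)) ?_)
    filter_upwards [ae_pathLaw_forall hg] with ω hω
      using abs_pacingCost_sub_sum_le hA hlo hlohi hω hcm T
  have hmid : |∑ t ∈ Finset.range T,
        ∫ ω, active A I t ω * (costAt A (projMult A I t ω) (ω t) - c) ∂(pathLaw V D)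
      - ρ * ∑ t ∈ Finset.range T, R t| ≤ Kq * ∑ t ∈ Finset.range T, Q t := by
    rw [Finset.mul_sum, Finset.mul_sum, ← Finset.sum_sub_distrib]
    exact (Finset.abs_sum_le_sum_abs _ _).trans (Finset.sum_le_sum fun t _ => (hcost t).2)
  have hρR := mul_le_mul hρ hRs (abs_nonneg _) (by positivity)
  rw [← abs_mul] at hρR
  have hKQ := mul_le_mul_of_nonneg_left hQs hKq0
  have e : pacingConst B I.lo I.hi lam Z₁ Z₂ G₂ * s
      = I.hi * Z₁ / lam * (((I.hi - I.lo) + (1 + (I.hi - I.lo) ^ 2 + B ^ 2) / 2) * s)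
        + Kq * (((I.hi - I.lo) ^ 2 + B ^ 2) / (2 * lam) * s) := by
    rw [pacingConst, hKq]; ring
  rw [e]
  rw [abs_le] at *
  constructor <;> linarith [hpath.1, hpath.2, hmid.1, hmid.2, hρR.1, hρR.2]

end

/-! ### The hitting time -/

/-- The set contains 0 and is bounded by `T`, so its supremum is attained; it is also closed
downwards. -/
theorem le_lastTime_iff {T : ℕ} {p : ℕ → Prop} {n : ℕ} :
    n ≤ lastTime T p ↔ n ≤ T ∧ ∀ s < n, p s := by
  have hb : BddAbove {n : ℕ | n ≤ T ∧ ∀ s < n, p s} := ⟨T, fun n hn => hn.1⟩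
  refine ⟨fun h => ?_, fun h => le_csSup hb h⟩
  have hmem := Nat.sSup_mem (s := {n : ℕ | n ≤ T ∧ ∀ s < n, p s}) ⟨0, by simp⟩ hb
  exact ⟨h.trans hmem.1, fun s hs => hmem.2 s (hs.trans_le h)⟩

theorem le_hittingTime_iff {A : Auction} {I : Input} {T : ℕ} {ω : ℕ → Sample} {n : ℕ} :
    n ≤ hittingTime A I T ω ↔ n ≤ T ∧ ∀ s < n, A.Δ / I.lo ≤ budget A I ω s ∧
      I.lo ≤ mult A I ω s ∧ mult A I ω s ≤ I.hi := by
  simp only [hittingTime, le_min_iff, le_lastTime_iff]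
  refine ⟨fun ⟨⟨h, h1⟩, ⟨_, h2⟩, ⟨_, h3⟩⟩ => ⟨h, fun s hs => ⟨h1 s hs, h2 s hs, h3 s hs⟩⟩,
    fun ⟨h, h'⟩ => ⟨⟨h, fun s hs => (h' s hs).1⟩, ⟨h, fun s hs => (h' s hs).2.1⟩,
      ⟨h, fun s hs => (h' s hs).2.2⟩⟩⟩

theorem hittingTime_le (A : Auction) (I : Input) (T : ℕ) (ω : ℕ → Sample) :
    hittingTime A I T ω ≤ T := (le_hittingTime_iff.1 le_rfl).1

theorem measurable_hittingTime (A : Auction) (I : Input) (T : ℕ) :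
    Measurable (hittingTime A I T) := by
  refine measurable_of_Ici fun n => ?_
  have : hittingTime A I T ⁻¹' Set.Ici n = {_ω | n ≤ T} ∩ ⋂ s ∈ Finset.range n,
      ({ω | A.Δ / I.lo ≤ budget A I ω s} ∩ ({ω | I.lo ≤ mult A I ω s} ∩
        {ω | mult A I ω s ≤ I.hi})) := by
    ext ω; simp [le_hittingTime_iff]
  rw [this]
  refine (MeasurableSet.const _).inter (Finset.measurableSet_biInter _ fun s _ => ?_)
  exact (measurableSet_le measurable_const (isPast_budget A I s).1).inter
    ((measurableSet_le measurable_const (isPast_mult A I s).1).inter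
      (measurableSet_le (isPast_mult A I s).1 measurable_const))

/-- All periods before the hitting time are active. Equality may fail, because activity tests only
the budget and not the multiplier. -/
theorem sum_one_sub_active_le (A : Auction) (I : Input) (T : ℕ) (ω : ℕ → Sample) :
    ∑ t ∈ Finset.range T, (1 - active A I t ω) ≤ (T : ℝ) - hittingTime A I T ω := by
  have hle := hittingTime_le A I T ω
  have h : ∑ t ∈ Finset.range (hittingTime A I T ω), (1 : ℝ)
      ≤ ∑ t ∈ Finset.range T, active A I t ω := by
    calc ∑ t ∈ Finset.range (hittingTime A I T ω), (1 : ℝ)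
        = ∑ t ∈ Finset.range (hittingTime A I T ω), active A I t ω := by
          refine Finset.sum_congr rfl fun t ht => (active_of_forall fun s hs => ?_).symm
          exact ((le_hittingTime_iff.1 le_rfl).2 s (hs.trans_lt (Finset.mem_range.1 ht))).1
      _ ≤ _ := Finset.sum_le_sum_of_subset_of_nonneg (Finset.range_mono hle)
          fun t _ _ => (active_mem A I t ω).1
  rw [Finset.sum_sub_distrib]
  simp only [Finset.sum_const, Finset.card_range, nsmul_eq_mul, mul_one] at h ⊢
  linarith

theorem integrable_sub_hittingTime (A : Auction) (I : Input) (T : ℕ) {P : Measure (ℕ → Sample)}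
    [IsProbabilityMeasure P] :
    Integrable (fun ω => (T : ℝ) - hittingTime A I T ω) P := by
  refine integrable_of_abs_le (C := T) ?_ (ae_of_all _ fun ω => ?_)
  · exact (measurable_const.sub
      ((measurable_of_countable (fun n : ℕ => (n : ℝ))).comp
        (measurable_hittingTime A I T))).aestronglyMeasurable
  · have : (hittingTime A I T ω : ℝ) ≤ T := by exact_mod_cast hittingTime_le A I T ω
    rw [abs_of_nonneg (by linarith)]
    linarith [(Nat.cast_nonneg (hittingTime A I T ω) : (0 : ℝ) ≤ _)]

/-! ### Confinement of the multiplier and the budget. -/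

section

variable {A : Auction} {I : Input} {B vlo dlo dhi : ℝ} {ω : ℕ → Sample}

/-- Since μ + εk is conserved, karma can run low only if the multiplier is high; the lower bound on
`k₁` is calibrated so that this would need a multiplier above `hi`. -/
theorem le_budget_of_mult_le (hε : 0 < I.ε) (hc : ControlsHitting A I vlo dlo dhi) {t : ℕ}
    (h : mult A I ω t ≤ I.hi) : A.Δ / I.lo ≤ budget A I ω t := by
  have hk := hc.lt_k₁
  have := mult_add_budget A I ω t
  have h1 : I.hi - I.μ₁ < (I.k₁ - A.Δ / I.lo) * I.ε := by
    rw [← div_lt_iff₀ hε]; linarith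
  refine le_of_mul_le_mul_left ?_ hε
  linarith

/-- The multiplier never exceeds its upper bound. -/
theorem mult_le_hi (hA : A.IsProper) (hlo : 0 < I.lo) (hμ : I.μ₁ ∈ Set.Icc I.lo I.hi)
    (hε : 0 < I.ε) (hdlo : 0 < dlo) (hdhi : 0 < dhi) (hc : ControlsHitting A I vlo dlo dhi)
    (hω : ∀ t, GoodSample B (ω t)) (hd : ∀ t, (ω t).2.1 ∈ Set.Icc dlo dhi) (t : ℕ) :
    mult A I ω t ≤ I.hi := by
  have hlohi := hμ.1.trans hμ.2
  induction t with
  | zero => exact hμ.2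
  | succ t ih =>
    -- Above Δ/`dlo` every bid is at most `dlo`, so the agent loses and the multiplier cannot rise.
    -- Below, one step is at most ε`dhi`, which is less than the gap up to `hi`.
    rcases lt_or_ge (A.Δ / dlo) (mult A I ω t) with h | h
    · have hbid := pacingBid_eq hA hlo hlohi (hω t) (le_budget_of_mult_le hε hc ih)
      have hq : A.Δ / dlo ≤ projMult A I t ω :=
        le_min (h.le.trans (le_max_left _ _)) hc.lt_hi.le
      have hlose : pacingBid A I ω t ≤ (ω t).2.1 := by
        refine le_trans ?_ (hd t).1
        rw [hbid, div_le_iff₀ (hlo.trans_le (projMult_mem hlohi t ω).1)]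
        rw [div_le_iff₀ hdlo] at hq
        have := mul_le_of_le_one_right hA.Δ_pos.le (hω t).val_le
        linarith
      have := payment_sub_gain_nonpos_of_lose hA (hω t).snd_nonneg (hω t).snd_le hlose
      rw [mult_succ]
      linarith [mul_nonpos_of_nonneg_of_nonpos hε.le this]
    · have hstep := (payment_sub_gain_le hA (b := pacingBid A I ω t) (hω t).snd_nonneg
        (hω t).snd_le).trans (hd t).2
      have hmul := mul_le_mul_of_nonneg_left hstep hε.le
      have he := hc.ε_lt.trans_le (min_le_right _ _)
      rw [one_div, ← div_eq_inv_mul, lt_div_iff₀ hdhi] at he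
      rw [mult_succ]
      linarith

/-- The multiplier never falls below its lower bound if a single step cannot cross it. -/
theorem lo_le_mult (hA : A.IsProper) (hlo : 0 < I.lo) (hμ : I.μ₁ ∈ Set.Icc I.lo I.hi)
    (hε : 0 < I.ε) (hdlo : 0 < dlo) (hdhi : 0 < dhi) (hc : ControlsHitting A I vlo dlo dhi)
    (hω : ∀ t, GoodSample B (ω t)) (hd : ∀ t, (ω t).2.1 ∈ Set.Icc dlo dhi)
    (hv : ∀ t, vlo ≤ (ω t).1) (hstep : I.ε * dhi ≤ A.Δ * vlo / dhi - I.lo) (t : ℕ) :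
    I.lo ≤ mult A I ω t := by
  have hlohi := hμ.1.trans hμ.2
  have hup := mult_le_hi hA hlo hμ hε hdlo hdhi hc hω hd
  induction t with
  | zero => exact hμ.1
  | succ t ih =>
    -- Below this threshold every bid exceeds `dhi`, so the agent wins and the multiplier cannot
    -- fall. Above it, one step down stays above `lo`.
    rcases lt_or_ge (mult A I ω t) (A.Δ * vlo / dhi) with h | h
    · have hbid := pacingBid_eq hA hlo hlohi (hω t) (le_budget_of_mult_le hε hc (hup t))
      have hq : projMult A I t ω = mult A I ω t := proj_of_mem ⟨ih, hup t⟩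
      have hwin : (ω t).2.1 < pacingBid A I ω t := by
        refine (hd t).2.trans_lt ?_
        rw [hbid, hq, lt_div_iff₀ (hlo.trans_le ih)]
        rw [lt_div_iff₀ hdhi] at h
        have := mul_le_mul_of_nonneg_left (hv t) hA.Δ_pos.le
        linarith
      have := payment_sub_gain_nonneg_of_win hA (hω t).fst_nonneg hwin
      rw [mult_succ]
      linarith [mul_nonneg hε.le this]
    · have hge := neg_le_payment_sub_gain hA (b := pacingBid A I ω t) (hω t).snd_nonneg
        (hω t).snd_le
      have hmul := mul_le_mul_of_nonneg_left
        (show -dhi ≤ payment (pacingBid A I ω t) (ω t).2 - gain A (pacingBid A I ω t) (ω t).2 by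
          linarith [(hd t).2]) hε.le
      rw [mult_succ]
      linarith

end

theorem residualGain_nonneg {A : Auction} {V : Measure ℝ} {D : Measure (ℝ × ℝ)} {νbar : ℝ}
    (h : IsModel A V D νbar) : 0 ≤ residualGain A D := by
  refine mul_nonneg h.isProper.share_nonneg (integral_nonneg_of_ae ?_)
  filter_upwards [h.bids] with d hd using sub_nonneg.2 hd.2

/-! ### Regret bounds -/

section

variable {A : Auction} {I : Input} {V : Measure ℝ} {D : Measure (ℝ × ℝ)} [IsProbabilityMeasure V]
  [IsProbabilityMeasure D] {νbar : ℝ} {T : ℕ} {lam Z₁ Z₂ G₁ G₂ μs : ℝ}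

omit [IsProbabilityMeasure V] [IsProbabilityMeasure D] in
theorem IsAdmissible.ae_goodSample (hM : IsModel A V D νbar)
    (hI : IsAdmissible A D I T lam Z₁ G₁ μs) :
    ∀ᵐ x ∂(V.prod D), GoodSample (A.Δ / I.lo) x :=
  hM.ae_goodSample (by filter_upwards [hI.support] with d hd using hd.1.2)

omit [IsProbabilityMeasure D] in
theorem IsAdmissible.k₁_pos (hI : IsAdmissible A D I T lam Z₁ G₁ μs) : 0 < I.k₁ := by
  by_contra h
  exact absurd hI.rate_pos (not_lt.2 (div_nonpos_of_nonpos_of_nonneg (not_lt.1 h)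
    (Nat.cast_nonneg T)))

omit [IsProbabilityMeasure D] in
-- Division by zero gives 0, so a positive budget rate excludes `T = 0`.
theorem IsAdmissible.horizon_pos (hI : IsAdmissible A D I T lam Z₁ G₁ μs) : (0 : ℝ) < T := by
  rcases Nat.eq_zero_or_pos T with rfl | h
  · simpa using hI.rate_pos
  · exact_mod_cast h

omit [IsProbabilityMeasure V] [IsProbabilityMeasure D] in
theorem expectedCost_stationary (h : HasRegularity A V D I.lo I.hi lam Z₁ Z₂ G₁ G₂ μs) :
    expectedCost A V D μs = dualObjective A V D μs := by
  rw [expectedCost, h.stationary, mul_zero, sub_zero]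

theorem integrable_regret (hM : IsModel A V D νbar) (hI : IsAdmissible A D I T lam Z₁ G₁ μs) :
    Integrable (regret A I T) (pathLaw V D) :=
  (integrable_pacingCost hM.isProper (hI.ae_goodSample hM) T).sub
    (integrable_hindsightCost hM.isProper (hI.ae_goodSample hM) hI.k₁_pos.le T)

theorem avgRegret_eq (hM : IsModel A V D νbar) (hI : IsAdmissible A D I T lam Z₁ G₁ μs) :
    avgRegret A V D I T = (∫ ω, pacingCost A I T ω ∂(pathLaw V D)) / T
      - (∫ ω, hindsightCost A I.k₁ T ω ∂(pathLaw V D)) / T := by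
  rw [avgRegret, ← sub_div, ← integral_sub
    (integrable_pacingCost hM.isProper (hI.ae_goodSample hM) T)
    (integrable_hindsightCost hM.isProper (hI.ae_goodSample hM) hI.k₁_pos.le T),
    one_div, ← div_eq_inv_mul]
  rfl

theorem avgRegret_nonneg (hM : IsModel A V D νbar) (hI : IsAdmissible A D I T lam Z₁ G₁ μs) :
    0 ≤ avgRegret A V D I T := by
  refine mul_nonneg (by positivity) (integral_nonneg_of_ae ?_)
  filter_upwards [ae_pathLaw_forall (hI.ae_goodSample hM)] with ω hω
  exact sub_nonneg.2 (hindsightCost_le_pacingCost hM.isProper hI.lo_pos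
    (hI.lo_lt.trans hI.lt_hi).le hω hI.k₁_pos.le T)

/-- Average form of the lower bound on the optimal cost in hindsight. -/
theorem le_avg_hindsightCost (hM : IsModel A V D νbar) (hI : IsAdmissible A D I T lam Z₁ G₁ μs)
    (h : HasRegularity A V D I.lo I.hi lam Z₁ Z₂ G₁ G₂ μs) :
    expectedCost A V D μs - I.hi * residualGain A D - I.hi * (I.k₁ / T)
      ≤ (∫ ω, hindsightCost A I.k₁ T ω ∂(pathLaw V D)) / T := by
  have hT := hI.horizon_pos
  have hlow := le_integral_hindsightCost hM.isProper (hI.ae_goodSample hM) hI.k₁_pos.le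
    (hI.lo_pos.trans hI.lo_lt) T
  have h1 := mul_le_mul_of_nonneg_right hI.lt_hi.le (residualGain_nonneg hM)
  have h2 := mul_le_mul_of_nonneg_right hI.lt_hi.le hI.k₁_pos.le
  rw [le_div_iff₀ hT, expectedCost_stationary h]
  have e : I.hi * (I.k₁ / T) * T = I.hi * I.k₁ := by field_simp
  have h3 := mul_le_mul_of_nonneg_left h1 hT.le
  linarith

theorem abs_avg_pacingCost_sub_le (hM : IsModel A V D νbar)
    (hI : IsAdmissible A D I T lam Z₁ G₁ μs) (hlam : 0 < lam) (hZ₁ : 0 < Z₁) (hZ₂ : 0 < Z₂)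
    (hG₂ : 0 < G₂) (h : HasRegularity A V D I.lo I.hi lam Z₁ Z₂ G₁ G₂ μs) :
    |(∫ ω, pacingCost A I T ω ∂(pathLaw V D)) / T - expectedCost A V D μs|
      ≤ pacingConst (A.Δ / I.lo) I.lo I.hi lam Z₁ Z₂ G₂ * (I.ε + 1 / (I.ε * T))
        + (∫ ω, ∑ t ∈ Finset.range T, (1 - active A I t ω) ∂(pathLaw V D)) / T := by
  have hT := hI.horizon_pos
  have hε := hI.ε_pos
  have hb := abs_integral_pacingCost_sub_le hM.isProper (hI.ae_goodSample hM) hI.lo_pos hI.ε_pos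
    hI.μ₁_mem hlam hZ₁ hZ₂ hG₂ h hI.lo_lt hI.lt_hi T
  have e1 : (∫ ω, pacingCost A I T ω ∂(pathLaw V D)) / T - expectedCost A V D μs
      = (∫ ω, pacingCost A I T ω ∂(pathLaw V D) - T * expectedCost A V D μs) / T := by
    field_simp
  have e2 : I.ε + 1 / (I.ε * T) = (1 / I.ε + I.ε * T) / T := by field_simp; ring
  rw [e1, e2, abs_div, abs_of_pos hT, ← mul_div_assoc, ← add_div]
  exact div_le_div_of_nonneg_right hb hT.le

/-- The regret bound for a finite horizon. -/
theorem avgRegret_le (hM : IsModel A V D νbar) (hI : IsAdmissible A D I T lam Z₁ G₁ μs)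
    (hlam : 0 < lam) (hZ₁ : 0 < Z₁) (hZ₂ : 0 < Z₂) (hG₂ : 0 < G₂)
    (h : HasRegularity A V D I.lo I.hi lam Z₁ Z₂ G₁ G₂ μs) :
    avgRegret A V D I T ≤ (pacingConst (A.Δ / I.lo) I.lo I.hi lam Z₁ Z₂ G₂ + 1 + I.hi) *
      (I.ε + 1 / (I.ε * T) + I.k₁ / T
        + (∫ ω, ((T : ℝ) - hittingTime A I T ω) ∂(pathLaw V D)) / T + residualGain A D) := by
  have hT := hI.horizon_pos
  have hε := hI.ε_pos
  have hK := pacingConst_nonneg (B := A.Δ / I.lo) hI.lo_pos (hI.lo_lt.trans hI.lt_hi) hlam hZ₁ hZ₂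
    hG₂
  have hhi : 0 < I.hi := hI.lo_pos.trans (hI.lo_lt.trans hI.lt_hi)
  have hp := (le_abs_self _).trans (abs_avg_pacingCost_sub_le hM hI hlam hZ₁ hZ₂ hG₂ h)
  have hh := le_avg_hindsightCost hM hI h
  have hact : (∫ ω, ∑ t ∈ Finset.range T, (1 - active A I t ω) ∂(pathLaw V D)) / T
      ≤ (∫ ω, ((T : ℝ) - hittingTime A I T ω) ∂(pathLaw V D)) / T := by
    refine div_le_div_of_nonneg_right (integral_mono
      (integrable_finsetSum _ fun t _ => (integrable_const _).sub (integrable_active A I t))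
      (integrable_sub_hittingTime A I T) fun ω => sum_one_sub_active_le A I T ω) hT.le
  rw [avgRegret_eq hM hI]
  set K := pacingConst (A.Δ / I.lo) I.lo I.hi lam Z₁ Z₂ G₂
  have a0 : 0 ≤ I.ε + 1 / (I.ε * T) := by positivity
  have a1 : 0 < I.k₁ / T := hI.rate_pos
  have a2 : 0 ≤ (∫ ω, ((T : ℝ) - hittingTime A I T ω) ∂(pathLaw V D)) / T := by
    refine div_nonneg (integral_nonneg fun ω => sub_nonneg.2 ?_) hT.le
    exact Nat.cast_le.2 (hittingTime_le A I T ω)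
  have a3 := residualGain_nonneg hM
  set x := I.ε + 1 / (I.ε * T)
  set y := I.k₁ / (T : ℝ)
  set z := (∫ ω, ((T : ℝ) - hittingTime A I T ω) ∂(pathLaw V D)) / T
  set r := residualGain A D
  -- The step-size terms need the factor `K`, the hitting time the factor 1, the budget and the
  -- residual gain the factor `hi`; the sum of the three serves for all.
  have b1 := mul_nonneg hK (add_nonneg (add_nonneg a1.le a2) a3)
  have b2 := mul_nonneg hhi.le (add_nonneg a0 a2)
  linarith [add_nonneg (add_nonneg a0 a1.le) a3]

variable {vlo dlo dhi : ℝ}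

omit [IsProbabilityMeasure V] [IsProbabilityMeasure D] in
theorem HasSupportBounds.ae_prod (hS : HasSupportBounds V D vlo dlo dhi) :
    ∀ᵐ x ∂(V.prod D), vlo ≤ x.1 ∧ x.2.1 ∈ Set.Icc dlo dhi := by
  have h1 : ∀ᵐ x ∂(V.prod D), x.1 ∈ Set.Icc vlo 1 :=
    Measure.quasiMeasurePreserving_fst.ae hS.valuation
  have h2 : ∀ᵐ x ∂(V.prod D), x.2.1 ∈ Set.Icc dlo dhi ∧ x.2.2 ∈ Set.Icc dlo dhi :=
    Measure.quasiMeasurePreserving_snd.ae hS.bids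
  filter_upwards [h1, h2] with x a b using ⟨a.1, b.1⟩

theorem ae_mult_le_hi (hM : IsModel A V D νbar) (hI : IsAdmissible A D I T lam Z₁ G₁ μs)
    (hS : HasSupportBounds V D vlo dlo dhi) (hC : ControlsHitting A I vlo dlo dhi) :
    ∀ᵐ ω ∂(pathLaw V D), ∀ t, mult A I ω t ≤ I.hi := by
  filter_upwards [ae_pathLaw_forall (hI.ae_goodSample hM), ae_pathLaw_forall hS.ae_prod]
    with ω hω hω'
  exact mult_le_hi hM.isProper hI.lo_pos hI.μ₁_mem hI.ε_pos hS.dlo_pos (hS.dlo_pos.trans hS.dlo_lt)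
    hC hω (fun t => (hω' t).2)

/-- The upper bound on the multiplier alone keeps every period active, so the limit needs no control
from below. -/
theorem integral_sum_one_sub_active (hM : IsModel A V D νbar)
    (hI : IsAdmissible A D I T lam Z₁ G₁ μs) (hS : HasSupportBounds V D vlo dlo dhi)
    (hC : ControlsHitting A I vlo dlo dhi) :
    ∫ ω, ∑ t ∈ Finset.range T, (1 - active A I t ω) ∂(pathLaw V D) = 0 := by
  refine integral_eq_zero_of_ae ?_
  filter_upwards [ae_mult_le_hi hM hI hS hC] with ω hω
  refine Finset.sum_eq_zero fun t _ => ?_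
  rw [active_of_forall fun s _ => le_budget_of_mult_le hI.ε_pos hC (hω s), sub_self]

theorem ae_hittingTime_eq (hM : IsModel A V D νbar) (hI : IsAdmissible A D I T lam Z₁ G₁ μs)
    (hS : HasSupportBounds V D vlo dlo dhi) (hC : ControlsHitting A I vlo dlo dhi)
    (hstep : I.ε * dhi ≤ A.Δ * vlo / dhi - I.lo) :
    ∀ᵐ ω ∂(pathLaw V D), hittingTime A I T ω = T := by
  filter_upwards [ae_pathLaw_forall (hI.ae_goodSample hM), ae_pathLaw_forall hS.ae_prod,
    ae_mult_le_hi hM hI hS hC] with ω hω hω' hup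
  refine le_antisymm (hittingTime_le A I T ω) (le_hittingTime_iff.2 ⟨le_rfl, fun s _ => ?_⟩)
  exact ⟨le_budget_of_mult_le hI.ε_pos hC (hup s),
    lo_le_mult hM.isProper hI.lo_pos hI.μ₁_mem hI.ε_pos hS.dlo_pos (hS.dlo_pos.trans hS.dlo_lt)
      hC hω (fun t => (hω' t).2) (fun t => (hω' t).1) hstep s, hup s⟩

end

/-- The average regret converges, and its limit is controlled by the residual gain. -/
theorem exists_tendsto_avgRegret {A : Auction} {V : Measure ℝ} {D : Measure (ℝ × ℝ)}
    [IsProbabilityMeasure V] [IsProbabilityMeasure D] {νbar lo hi lam Z₁ Z₂ G₁ G₂ μs : ℝ}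
    {vlo dlo dhi : ℝ} {ε μ₁ k₁ : ℕ → ℝ} (hM : IsModel A V D νbar) (hlam : 0 < lam) (hZ₁ : 0 < Z₁)
    (hZ₂ : 0 < Z₂) (hG₂ : 0 < G₂) (h : HasRegularity A V D lo hi lam Z₁ Z₂ G₁ G₂ μs)
    (hS : HasSupportBounds V D vlo dlo dhi)
    (hk : Tendsto (fun T : ℕ => k₁ T / T) atTop (𝓝 0)) (hε : Tendsto ε atTop (𝓝 0))
    (hεT : Tendsto (fun T : ℕ => T * ε T) atTop atTop)
    (hI : ∀ᶠ T : ℕ in atTop, IsAdmissible A D ⟨lo, hi, ε T, μ₁ T, k₁ T⟩ T lam Z₁ G₁ μs)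
    (hC : ∀ᶠ T : ℕ in atTop, ControlsHitting A ⟨lo, hi, ε T, μ₁ T, k₁ T⟩ vlo dlo dhi) :
    ∃ l : ℝ, Tendsto (fun T : ℕ => avgRegret A V D ⟨lo, hi, ε T, μ₁ T, k₁ T⟩ T) atTop (𝓝 l) ∧
      0 ≤ l ∧ l ≤ hi * residualGain A D := by
  obtain ⟨T₀, hI₀⟩ := hI.exists
  have hg := hI₀.ae_goodSample hM
  obtain ⟨c, hc⟩ := exists_tendsto_hindsightCost hM.isProper hg hS.dlo_pos
    (by filter_upwards [hS.ae_prod] with x hx using hx.2.1) (k := k₁)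
    (by filter_upwards [hI] with T hT using hT.k₁_pos.le) hk
  have hp : Tendsto (fun T : ℕ => (∫ ω, pacingCost A ⟨lo, hi, ε T, μ₁ T, k₁ T⟩ T ω
      ∂(pathLaw V D)) / T) atTop (𝓝 (expectedCost A V D μs)) := by
    rw [tendsto_iff_dist_tendsto_zero]
    have hrate : Tendsto (fun T : ℕ => pacingConst (A.Δ / lo) lo hi lam Z₁ Z₂ G₂ *
        (ε T + 1 / (ε T * T))) atTop (𝓝 0) := by
      have h1 : Tendsto (fun T : ℕ => 1 / (ε T * T)) atTop (𝓝 0) := by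
        simp only [one_div, mul_comm (ε _)]
        exact hεT.inv_tendsto_atTop
      simpa using (hε.add h1).const_mul (pacingConst (A.Δ / lo) lo hi lam Z₁ Z₂ G₂)
    refine squeeze_zero' (Eventually.of_forall fun T => dist_nonneg) ?_ hrate
    filter_upwards [hI, hC] with T hIT hCT
    have := abs_avg_pacingCost_sub_le hM hIT hlam hZ₁ hZ₂ hG₂ h
    rw [integral_sum_one_sub_active hM hIT hS hCT, zero_div, add_zero] at this
    exact this
  have hlim : Tendsto (fun T : ℕ => avgRegret A V D ⟨lo, hi, ε T, μ₁ T, k₁ T⟩ T) atTop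
      (𝓝 (expectedCost A V D μs - c)) := by
    refine (hp.sub hc).congr' ?_
    filter_upwards [hI] with T hT using (avgRegret_eq hM hT).symm
  refine ⟨_, hlim, ?_, ?_⟩
  · refine ge_of_tendsto hlim ?_
    filter_upwards [hI] with T hT using avgRegret_nonneg hM hT
  -- Weak duality passes to the limit: the budget term vanishes and only the residual gain separates
  -- the two limits.
  · have hlow : Tendsto (fun T : ℕ => expectedCost A V D μs - hi * residualGain A D
        - hi * (k₁ T / T)) atTop (𝓝 (expectedCost A V D μs - hi * residualGain A D)) := by
      simpa using (hk.const_mul hi).const_sub (expectedCost A V D μs - hi * residualGain A D)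
    have := le_of_tendsto_of_tendsto hlow hc
      (by filter_upwards [hI] with T hT using le_avg_hindsightCost hM hT h)
    linarith

end KarmaPacing

theorem theorem4p1
    (Δ lo hi lam Z₁ Z₂ G₁ G₂ νbar : ℝ) (hlo : 0 < lo) (hlohi : lo < hi) (hlam : 0 < lam)
    (hZ₁ : 0 < Z₁) (hZ₂ : 0 < Z₂) (hG₁ : 0 < G₁) (hG₂ : 0 < G₂) :
    ∃ C : ℝ, 0 ≤ C ∧
      ∀ (γ N : ℕ) (V : Measure ℝ) (D : Measure (ℝ × ℝ))
        [IsProbabilityMeasure V] [IsProbabilityMeasure D] (μs : ℝ),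
        IsModel ⟨Δ, γ, N⟩ V D νbar →
        HasRegularity ⟨Δ, γ, N⟩ V D lo hi lam Z₁ Z₂ G₁ G₂ μs →
        -- the bound for a finite horizon
        (∀ (T : ℕ) (ε μ₁ k₁ : ℝ), 1 ≤ T →
          IsAdmissible ⟨Δ, γ, N⟩ D ⟨lo, hi, ε, μ₁, k₁⟩ T lam Z₁ G₁ μs →
          Integrable (regret ⟨Δ, γ, N⟩ ⟨lo, hi, ε, μ₁, k₁⟩ T) (pathLaw V D) ∧
          Integrable (fun ω => (T : ℝ) - hittingTime ⟨Δ, γ, N⟩ ⟨lo, hi, ε, μ₁, k₁⟩ T ω)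
            (pathLaw V D) ∧
          avgRegret ⟨Δ, γ, N⟩ V D ⟨lo, hi, ε, μ₁, k₁⟩ T ≤
            C * (ε + 1 / (ε * T) + k₁ / T
              + (∫ ω, ((T : ℝ) - hittingTime ⟨Δ, γ, N⟩ ⟨lo, hi, ε, μ₁, k₁⟩ T ω)
                  ∂(pathLaw V D)) / T
              + residualGain ⟨Δ, γ, N⟩ D)) ∧
        -- the limit for a growing horizon
        (∀ (vlo dlo dhi : ℝ) (ε μ₁ k₁ : ℕ → ℝ),
          HasSupportBounds V D vlo dlo dhi →
          Tendsto (fun T : ℕ => k₁ T / T) atTop (𝓝 0) →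
          Tendsto ε atTop (𝓝 0) →
          Tendsto (fun T : ℕ => T * ε T) atTop atTop →
          (∀ᶠ T : ℕ in atTop,
            IsAdmissible ⟨Δ, γ, N⟩ D ⟨lo, hi, ε T, μ₁ T, k₁ T⟩ T lam Z₁ G₁ μs) →
          (∀ᶠ T : ℕ in atTop,
            ControlsHitting ⟨Δ, γ, N⟩ ⟨lo, hi, ε T, μ₁ T, k₁ T⟩ vlo dlo dhi) →
          (∃ l : ℝ,
            Tendsto (fun T : ℕ => avgRegret ⟨Δ, γ, N⟩ V D ⟨lo, hi, ε T, μ₁ T, k₁ T⟩ T)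
              atTop (𝓝 l) ∧
            |l| ≤ C * residualGain ⟨Δ, γ, N⟩ D) ∧
          (lo < Δ * vlo / dhi →
            ∀ᶠ T : ℕ in atTop, ∀ᵐ ω ∂(pathLaw V D),
              hittingTime ⟨Δ, γ, N⟩ ⟨lo, hi, ε T, μ₁ T, k₁ T⟩ T ω = T)) := by
  have hhi : 0 < hi := hlo.trans hlohi
  have hK := pacingConst_nonneg (B := Δ / lo) hlo hlohi hlam hZ₁ hZ₂ hG₂
  refine ⟨pacingConst (Δ / lo) lo hi lam Z₁ Z₂ G₂ + 1 + hi, by positivity, ?_⟩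
  intro γ N V D _ _ μs hM h
  refine ⟨fun T ε μ₁ k₁ _ hI => ⟨integrable_regret hM hI, integrable_sub_hittingTime _ _ _,
    avgRegret_le hM hI hlam hZ₁ hZ₂ hG₂ h⟩, ?_⟩
  intro vlo dlo dhi ε μ₁ k₁ hS hk hε hεT hI hC
  refine ⟨?_, fun hlow => ?_⟩
  · obtain ⟨l, hl, h0, h1⟩ := exists_tendsto_avgRegret hM hlam hZ₁ hZ₂ hG₂ h hS hk hε hεT hI hC
    refine ⟨l, hl, ?_⟩
    rw [abs_of_nonneg h0]
    refine h1.trans (mul_le_mul_of_nonneg_right ?_ (residualGain_nonneg hM))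
    linarith
  -- For `dhi < 1` the bound on ε in `ControlsHitting` does not imply this inequality; it follows
  -- eventually from ε → 0 and the strict gap.
  · have hstep : ∀ᶠ T in atTop, ε T * dhi ≤ Δ * vlo / dhi - lo := by
      have : Tendsto (fun T => ε T * dhi) atTop (𝓝 0) := by simpa using hε.mul_const dhi
      exact this.eventually (eventually_le_nhds (sub_pos.2 hlow))
    filter_upwards [hI, hC, hstep] with T hIT hCT hT using ae_hittingTime_eq hM hIT hS hCT hT
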